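/- A JB*-triple is a complex Banach space $Z$ with a continuous triple product $\{x,y,z\}$, complex linear and symmetric in the outer variables and conjugate linear in the middle one, such that, with $(x\Box y)(z)=\{x,y,z\}$, for all $x\in Z$: $\|\{x,x,x\}\|=\|x\|^3$; $i\,x\Box x$ is a derivation of the triple product; $x\Box x$ has non-negative spectrum; and $\exp(it\,x\Box x)$, $t\in\mathbb R$, is an isometry. The direct sum $Z_1\oplus Z_2$ carries the componentwise triple product and the maximum norm. A ternary ring of operators (TRO) is a closed subspace $T$ of a C*-algebra with $TT^*T\subseteq T$; $\mathcal L(T)=\overline{\mathrm{span}}\,TT^*$, $\mathcal R(T)=\overline{\mathrm{span}}\,T^*T$, and $\mathrm{Li}(T)=\begin{pmatrix}\mathcal L(T)&T\\T^*&\mathcal R(T)\end{pmatrix}$ are its left, right and linking C*-algebras, with corner embeddings $\iota_{\mathcal L}:\mathcal L(T)\to\mathrm{Li}(T)$ and $\iota_{\mathcal R}:\mathcal R(T)\to\mathrm{Li}(T)$. A JB*-morphism of $Z$ into a TRO is a bounded linear map that is a homomorphism for the product $\{a,b,c\}=\tfrac12(ab^*c+cb^*a)$. Let $\rho_Z:Z\to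 T^*(Z)$ be the universal enveloping TRO of $Z$: $\rho_Z$ is a JB*-morphism, $\rho_Z(Z)$ generates $T^*(Z)$ as a TRO, and every JB*-morphism of $Z$ into a TRO factors through $\rho_Z$ by a unique TRO-morphism. The K-JB* invariant of a finite-dimensional JB*-triple $Z$ is the tuple $$\mathcal{KJB^*}(Z)=\bigl(K_0^{JB^*}(Z),\,K_0^{JB^*}(Z)_+,\,\Sigma_{\mathcal L}(Z),\,\Sigma_{\mathcal R}(Z),\,\Delta(Z)\bigr),$$ where $K_0^{JB^*}(Z)=K_0(\mathcal L(T^*(Z)))$; $K_0^{JB^*}(Z)_+$ is the set of classes of projections in matrix algebras over $\mathcal L(T^*(Z))$; $\Sigma_{\mathcal L}(Z)$ is the set of classes of projections of $\mathcal L(T^*(Z))$ itself; $\Sigma_{\mathcal R}(Z)$ is the set of classes of projections of $\mathcal R(T^*(Z))$, transported to $K_0(\mathcal L(T^*(Z)))$ by $K_0(\iota_{\mathcal L})^{-1}K_0(\iota_{\mathcal R})$; and $\Delta(Z)=\{[\rho_Z(g)\rho_Z(g)^*] : g\in Z,\ \{g,g,g\}=g\}$. The direct sum of two such tuples is formed componentwise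 (product group, product subsets). A $\mathcal{KJB^*}$-isomorphism is a group isomorphism such that it and its inverse map each of the four distinguished subsets into the corresponding one. **Proposition.** Let $Z_1$ and $Z_2$ be finite-dimensional JB*-triples. Then there is a $\mathcal{KJB^*}$-isomorphism $$\mathcal{KJB^*}(Z_1\oplus Z_2)\simeq\mathcal{KJB^*}(Z_1)\oplus\mathcal{KJB^*}(Z_2).$$ -/

import Mathlib

open scoped Matrix ENNReal

universe w u₁ u₂

/-! ### JB*-triples -/

/-- A complex Banach space `Z` with a continuous triple product `{x, y, z} = tp x y z` which is
complex linear and symmetric in the outer variables and conjugate linear in the middle one. -/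
class TripleSystem (Z : Type*) [NormedAddCommGroup Z] [NormedSpace ℂ Z] [CompleteSpace Z] where
  tp : Z → Z → Z → Z
  tp_add_left : ∀ x x' y z, tp (x + x') y z = tp x y z + tp x' y z
  tp_smul_left : ∀ (c : ℂ) x y z, tp (c • x) y z = c • tp x y z
  tp_add_mid : ∀ x y y' z, tp x (y + y') z = tp x y z + tp x y' z
  tp_smul_mid : ∀ (c : ℂ) x y z, tp x (c • y) z = (starRingEnd ℂ c) • tp x y z
  tp_symm : ∀ x y z, tp x y z = tp z y x
  continuous_tp : Continuous fun p : Z × Z × Z => tp p.1 p.2.1 p.2.2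

section JB
variable {Z : Type*} [NormedAddCommGroup Z] [NormedSpace ℂ Z] [CompleteSpace Z]

/-- The triple product. -/
abbrev tp [TripleSystem Z] (x y z : Z) : Z := TripleSystem.tp x y z

/-- The bounded operator `x □ y : z ↦ {x, y, z}`. -/
def box [TripleSystem Z] (x y : Z) : Z →L[ℂ] Z where
  toFun z := tp x y z
  map_add' z z' := by
    simp only [tp, TripleSystem.tp_symm x y, TripleSystem.tp_add_left]
  map_smul' c z := by
    simp only [tp, TripleSystem.tp_symm x y, TripleSystem.tp_smul_left, RingHom.id_apply]
  cont := by
    have h : Continuous fun z : Z => ((x, y, z) : Z × Z × Z) := by fun_prop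
    exact TripleSystem.continuous_tp.comp h

/-- `D` is a derivation of the triple product. -/
def IsTripleDerivation [TripleSystem Z] (D : Z →L[ℂ] Z) : Prop :=
  ∀ a b c : Z, D (tp a b c) = tp (D a) b c + tp a (D b) c + tp a b (D c)

end JB

/-- A JB*-triple. -/
class JBStarTriple (Z : Type*) [NormedAddCommGroup Z] [NormedSpace ℂ Z] [CompleteSpace Z]
    extends TripleSystem Z where
  norm_tp_self : ∀ x : Z, ‖tp x x x‖ = ‖x‖ ^ 3
  derivation : ∀ x : Z, IsTripleDerivation (Complex.I • box x x)
  spectrum_nonneg : ∀ x : Z, ∀ c ∈ spectrum ℂ (box x x), c.im = 0 ∧ 0 ≤ c.re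
  norm_exp : ∀ (x : Z) (t : ℝ) (z : Z),
    ‖NormedSpace.exp ((Complex.I * (t : ℂ)) • box x x) z‖ = ‖z‖

section Prod
variable {Z₁ : Type*} [NormedAddCommGroup Z₁] [NormedSpace ℂ Z₁] [CompleteSpace Z₁]
variable {Z₂ : Type*} [NormedAddCommGroup Z₂] [NormedSpace ℂ Z₂] [CompleteSpace Z₂]

/-- The direct sum of two triples: the norm on `Z₁ × Z₂` is the maximum norm. -/
instance TripleSystem.instProd [TripleSystem Z₁] [TripleSystem Z₂] : TripleSystem (Z₁ × Z₂) where
  tp x y z := (tp x.1 y.1 z.1, tp x.2 y.2 z.2)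
  tp_add_left x x' y z := by
    ext <;> simp [TripleSystem.tp_add_left]
  tp_smul_left c x y z := by
    ext <;> simp [TripleSystem.tp_smul_left]
  tp_add_mid x y y' z := by
    ext <;> simp [TripleSystem.tp_add_mid]
  tp_smul_mid c x y z := by
    ext <;> simp [TripleSystem.tp_smul_mid]
  tp_symm x y z := by
    ext
    · exact TripleSystem.tp_symm _ _ _
    · exact TripleSystem.tp_symm _ _ _
  continuous_tp := by
    have h1 : Continuous fun p : (Z₁ × Z₂) × (Z₁ × Z₂) × (Z₁ × Z₂) =>
        ((p.1.1, p.2.1.1, p.2.2.1) : Z₁ × Z₁ × Z₁) := by fun_prop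
    have h2 : Continuous fun p : (Z₁ × Z₂) × (Z₁ × Z₂) × (Z₁ × Z₂) =>
        ((p.1.2, p.2.1.2, p.2.2.2) : Z₂ × Z₂ × Z₂) := by fun_prop
    exact (TripleSystem.continuous_tp.comp h1).prodMk (TripleSystem.continuous_tp.comp h2)

/-- Block diagonal operators, as an algebra homomorphism. -/
def prodMapAlgHom : ((Z₁ →L[ℂ] Z₁) × (Z₂ →L[ℂ] Z₂)) →ₐ[ℂ] (Z₁ × Z₂ →L[ℂ] Z₁ × Z₂) where
  toFun p := p.1.prodMap p.2
  map_one' := by ext <;> simp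
  map_mul' p q := by ext <;> simp
  map_zero' := by ext <;> simp
  map_add' p q := by ext <;> simp
  commutes' c := by ext <;> simp [Algebra.algebraMap_eq_smul_one]

theorem box_prod [TripleSystem Z₁] [TripleSystem Z₂] (x y : Z₁ × Z₂) :
    box x y = prodMapAlgHom (box x.1 y.1, box x.2 y.2) := rfl

theorem continuous_prodMapAlgHom :
    Continuous (prodMapAlgHom : ((Z₁ →L[ℂ] Z₁) × (Z₂ →L[ℂ] Z₂)) →ₐ[ℂ] _) :=
  (ContinuousLinearMap.prodMapL ℂ Z₁ Z₁ Z₂ Z₂).continuous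

/-- The direct sum of two JB*-triples is a JB*-triple. -/
instance JBStarTriple.instProd [JBStarTriple Z₁] [JBStarTriple Z₂] : JBStarTriple (Z₁ × Z₂) where
  norm_tp_self x := by
    have h1 := JBStarTriple.norm_tp_self x.1
    have h2 := JBStarTriple.norm_tp_self x.2
    change max ‖tp x.1 x.1 x.1‖ ‖tp x.2 x.2 x.2‖ = (max ‖x.1‖ ‖x.2‖) ^ 3
    rw [h1, h2]
    rcases le_total ‖x.1‖ ‖x.2‖ with h | h
    · rw [max_eq_right h, max_eq_right (by gcongr)]
    · rw [max_eq_left h, max_eq_left (by gcongr)]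
  derivation x a b c := by
    ext
    · exact JBStarTriple.derivation x.1 a.1 b.1 c.1
    · exact JBStarTriple.derivation x.2 a.2 b.2 c.2
  spectrum_nonneg x c hc := by
    rw [box_prod] at hc
    have := AlgHom.spectrum_apply_subset _ _ hc
    rw [Prod.spectrum_eq] at this
    rcases this with h | h
    · exact JBStarTriple.spectrum_nonneg _ _ h
    · exact JBStarTriple.spectrum_nonneg _ _ h
  norm_exp x t z := by
    let _ : NormedAlgebra ℚ ((Z₁ →L[ℂ] Z₁) × (Z₂ →L[ℂ] Z₂)) := NormedAlgebra.restrictScalars ℚ ℂ _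
    let _ : NormedAlgebra ℚ (Z₁ →L[ℂ] Z₁) := NormedAlgebra.restrictScalars ℚ ℂ _
    let _ : NormedAlgebra ℚ (Z₂ →L[ℂ] Z₂) := NormedAlgebra.restrictScalars ℚ ℂ _
    let _ : NormedAlgebra ℚ (Z₁ × Z₂ →L[ℂ] Z₁ × Z₂) := NormedAlgebra.restrictScalars ℚ ℂ _
    rw [box_prod, ← map_smul, ← NormedSpace.map_exp _ continuous_prodMapAlgHom]
    have h1 := JBStarTriple.norm_exp x.1 t z.1
    have h2 := JBStarTriple.norm_exp x.2 t z.2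
    have e : NormedSpace.exp ((Complex.I * (t : ℂ)) • (box x.1 x.1, box x.2 x.2)) =
        (NormedSpace.exp ((Complex.I * (t : ℂ)) • box x.1 x.1),
          NormedSpace.exp ((Complex.I * (t : ℂ)) • box x.2 x.2)) := by
      ext1
      · rw [Prod.fst_exp]; rfl
      · rw [Prod.snd_exp]; rfl
    rw [e]
    change max ‖NormedSpace.exp ((Complex.I * (t : ℂ)) • box x.1 x.1) z.1‖
      ‖NormedSpace.exp ((Complex.I * (t : ℂ)) • box x.2 x.2) z.2‖ = max ‖z.1‖ ‖z.2‖
    rw [h1, h2]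

end Prod

/-! ### Ternary rings of operators -/

/-- A ternary ring of operators: a norm closed linear subspace `T` of a C*-algebra `A` with
`T T* T ⊆ T`. -/
structure TRO (A : Type*) [NonUnitalCStarAlgebra A] extends Submodule ℂ A where
  isClosed' : IsClosed carrier
  triple_mem' : ∀ {x y z : A}, x ∈ carrier → y ∈ carrier → z ∈ carrier →
    x * star y * z ∈ carrier

namespace TRO
variable {A : Type*} [NonUnitalCStarAlgebra A]

/-- The smallest TRO in `A` containing `s`. -/
def generate (s : Set A) : TRO A where
  carrier := {x | ∀ T : TRO A, s ⊆ T.carrier → x ∈ T.carrier}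
  add_mem' hx hy T hT := T.add_mem (hx T hT) (hy T hT)
  zero_mem' T _ := T.zero_mem
  smul_mem' c _ hx T hT := T.smul_mem c (hx T hT)
  isClosed' := by
    simp only [Set.ofPred_forall]
    exact isClosed_iInter fun T => isClosed_iInter fun _ => T.isClosed'
  triple_mem' hx hy hz T hT := T.triple_mem' (hx T hT) (hy T hT) (hz T hT)

theorem subset_generate (s : Set A) : s ⊆ (generate s).carrier := fun _ hx _ hT => hT hx

theorem closure_mul_mem {s : Set A} (h : ∀ x ∈ s, ∀ y ∈ s, x * y ∈ Submodule.span ℂ s) {a b : A}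
    (ha : a ∈ (Submodule.span ℂ s).topologicalClosure)
    (hb : b ∈ (Submodule.span ℂ s).topologicalClosure) :
    a * b ∈ (Submodule.span ℂ s).topologicalClosure := by
  refine map_mem_closure₂ continuous_mul ha hb fun x hx y hy => ?_
  induction hx using Submodule.span_induction with
  | mem x hx =>
    induction hy using Submodule.span_induction with
    | mem y hy => exact h x hx y hy
    | zero => simp
    | add y z _ _ h1 h2 => rw [mul_add]; exact Submodule.add_mem _ h1 h2
    | smul c y _ h1 => rw [mul_smul_comm]; exact Submodule.smul_mem _ c h1
  | zero => simp
  | add y z _ _ h1 h2 => rw [add_mul]; exact Submodule.add_mem _ h1 h2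
  | smul c y _ h1 => rw [smul_mul_assoc]; exact Submodule.smul_mem _ c h1

theorem closure_star_mem {s : Set A} (h : ∀ x ∈ s, star x ∈ Submodule.span ℂ s) {a : A}
    (ha : a ∈ (Submodule.span ℂ s).topologicalClosure) :
    star a ∈ (Submodule.span ℂ s).topologicalClosure := by
  refine map_mem_closure continuous_star ha fun x hx => ?_
  induction hx using Submodule.span_induction with
  | mem x hx => exact h x hx
  | zero => simp
  | add y z _ _ h1 h2 => rw [star_add]; exact Submodule.add_mem _ h1 h2
  | smul c y _ h1 => rw [star_smul]; exact Submodule.smul_mem _ _ h1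

/-- The left C*-algebra `L(T)`: the closed linear span of `T T*`. -/
def leftAlg (T : TRO A) : NonUnitalStarSubalgebra ℂ A where
  toSubmodule := (Submodule.span ℂ {a : A | ∃ x ∈ T.carrier, ∃ y ∈ T.carrier,
    a = x * star y}).topologicalClosure
  mul_mem' ha hb := by
    refine closure_mul_mem ?_ ha hb
    rintro _ ⟨x, hx, y, hy, rfl⟩ _ ⟨x', hx', y', hy', rfl⟩
    exact Submodule.subset_span ⟨_, T.triple_mem' hx hy hx', y', hy', by simp only [mul_assoc]⟩
  star_mem' ha := by
    refine closure_star_mem ?_ ha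
    rintro _ ⟨x, hx, y, hy, rfl⟩
    exact Submodule.subset_span ⟨y, hy, x, hx, by simp⟩

/-- The right C*-algebra `R(T)`: the closed linear span of `T* T`. -/
def rightAlg (T : TRO A) : NonUnitalStarSubalgebra ℂ A where
  toSubmodule := (Submodule.span ℂ {a : A | ∃ x ∈ T.carrier, ∃ y ∈ T.carrier,
    a = star x * y}).topologicalClosure
  mul_mem' ha hb := by
    refine closure_mul_mem ?_ ha hb
    rintro _ ⟨x, hx, y, hy, rfl⟩ _ ⟨x', hx', y', hy', rfl⟩
    exact Submodule.subset_span ⟨x, hx, _, T.triple_mem' hy hx' hy', by simp only [mul_assoc]⟩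
  star_mem' ha := by
    refine closure_star_mem ?_ ha
    rintro _ ⟨x, hx, y, hy, rfl⟩
    exact Submodule.subset_span ⟨y, hy, x, hx, by simp⟩

theorem mul_star_mem_leftAlg (T : TRO A) {x y : A} (hx : x ∈ T.carrier) (hy : y ∈ T.carrier) :
    x * star y ∈ T.leftAlg :=
  Submodule.le_topologicalClosure _ (Submodule.subset_span ⟨x, hx, y, hy, rfl⟩)

theorem star_mul_mem_rightAlg (T : TRO A) {x y : A} (hx : x ∈ T.carrier) (hy : y ∈ T.carrier) :
    star x * y ∈ T.rightAlg :=
  Submodule.le_topologicalClosure _ (Submodule.subset_span ⟨x, hx, y, hy, rfl⟩)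

theorem leftAlg_mul_mem (T : TRO A) {a x : A} (ha : a ∈ T.leftAlg) (hx : x ∈ T.carrier) :
    a * x ∈ T.carrier := by
  rw [← T.isClosed'.closure_eq]
  refine map_mem_closure (f := fun a => a * x) (by fun_prop) ha fun b hb => ?_
  change b ∈ Submodule.span ℂ _ at hb
  induction hb using Submodule.span_induction with
  | mem b hb =>
    obtain ⟨y, hy, z, hz, rfl⟩ := hb
    exact T.triple_mem' hy hz hx
  | zero => simp
  | add y z _ _ h1 h2 => simp only [add_mul]; exact T.add_mem h1 h2
  | smul c y _ h1 => simp only [smul_mul_assoc]; exact T.smul_mem c h1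

theorem mul_rightAlg_mem (T : TRO A) {a x : A} (ha : a ∈ T.rightAlg) (hx : x ∈ T.carrier) :
    x * a ∈ T.carrier := by
  rw [← T.isClosed'.closure_eq]
  refine map_mem_closure (f := fun a => x * a) (by fun_prop) ha fun b hb => ?_
  change b ∈ Submodule.span ℂ _ at hb
  induction hb using Submodule.span_induction with
  | mem b hb =>
    obtain ⟨y, hy, z, hz, rfl⟩ := hb
    change x * (star y * z) ∈ T.carrier
    rw [← mul_assoc]
    exact T.triple_mem' hx hy hz
  | zero => simp
  | add y z _ _ h1 h2 => simp only [mul_add]; exact T.add_mem h1 h2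
  | smul c y _ h1 => simp only [mul_smul_comm]; exact T.smul_mem c h1

/-- The linking algebra `[[L(T), T], [T*, R(T)]]`, as an algebra of `2 × 2` matrices. -/
def linkingAlg (T : TRO A) : NonUnitalStarSubalgebra ℂ (Matrix (Fin 2) (Fin 2) A) where
  carrier := {M | M 0 0 ∈ T.leftAlg ∧ M 0 1 ∈ T.carrier ∧ star (M 1 0) ∈ T.carrier ∧
    M 1 1 ∈ T.rightAlg}
  add_mem' {M N} hM hN := by
    refine ⟨add_mem hM.1 hN.1, T.add_mem hM.2.1 hN.2.1, ?_, add_mem hM.2.2.2 hN.2.2.2⟩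
    rw [Matrix.add_apply, star_add]
    exact T.add_mem hM.2.2.1 hN.2.2.1
  zero_mem' := by
    refine ⟨zero_mem _, T.zero_mem, ?_, zero_mem _⟩
    rw [Matrix.zero_apply, star_zero]
    exact T.zero_mem
  smul_mem' c M hM := by
    refine ⟨SMulMemClass.smul_mem c hM.1, T.smul_mem c hM.2.1, ?_,
      SMulMemClass.smul_mem c hM.2.2.2⟩
    rw [Matrix.smul_apply, star_smul]
    exact T.smul_mem _ hM.2.2.1
  mul_mem' {M N} hM hN := by
    obtain ⟨a, b, c, d⟩ := hM
    obtain ⟨a', b', c', d'⟩ := hN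
    simp only [Set.mem_ofPred_eq, Matrix.mul_apply, Fin.sum_univ_two, star_add, star_mul]
    refine ⟨add_mem (mul_mem a a') ?_, T.add_mem (T.leftAlg_mul_mem a b') (T.mul_rightAlg_mem d' b),
      T.add_mem (T.leftAlg_mul_mem (star_mem a') c) (T.mul_rightAlg_mem (star_mem d) c'),
      add_mem ?_ (mul_mem d d')⟩
    · simpa using T.mul_star_mem_leftAlg b c'
    · simpa using T.star_mul_mem_rightAlg c b'
  star_mem' {M} hM := by
    obtain ⟨a, b, c, d⟩ := hM
    refine ⟨star_mem a, c, ?_, star_mem d⟩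
    simpa [Matrix.star_apply] using b

/-- The corner embedding `ι_L : L(T) → Li(T)`. -/
def leftIncl (T : TRO A) : T.leftAlg →⋆ₙₐ[ℂ] T.linkingAlg where
  toFun a := ⟨!![(a : A), 0; 0, 0], a.2, T.zero_mem, by simp, zero_mem _⟩
  map_smul' c a := by
    ext i j; fin_cases i <;> fin_cases j <;> simp
  map_zero' := by
    ext i j; fin_cases i <;> fin_cases j <;> simp
  map_add' a b := by
    ext i j; fin_cases i <;> fin_cases j <;> simp
  map_mul' a b := by
    ext i j; fin_cases i <;> fin_cases j <;> simp [Matrix.mul_apply, Fin.sum_univ_two]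
  map_star' a := by
    ext i j; fin_cases i <;> fin_cases j <;> simp [Matrix.star_apply]

/-- The corner embedding `ι_R : R(T) → Li(T)`. -/
def rightIncl (T : TRO A) : T.rightAlg →⋆ₙₐ[ℂ] T.linkingAlg where
  toFun a := ⟨!![0, 0; 0, (a : A)], zero_mem _, T.zero_mem, by simp, a.2⟩
  map_smul' c a := by
    ext i j; fin_cases i <;> fin_cases j <;> simp
  map_zero' := by
    ext i j; fin_cases i <;> fin_cases j <;> simp
  map_add' a b := by
    ext i j; fin_cases i <;> fin_cases j <;> simp
  map_mul' a b := by
    ext i j; fin_cases i <;> fin_cases j <;> simp [Matrix.mul_apply, Fin.sum_univ_two]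
  map_star' a := by
    ext i j; fin_cases i <;> fin_cases j <;> simp [Matrix.star_apply]

end TRO

/-! ### The universal enveloping TRO -/

section Universal
variable (Z : Type u₁) [NormedAddCommGroup Z] [NormedSpace ℂ Z] [CompleteSpace Z]

/-- A JB*-morphism from `Z` into a C*-algebra `B` with its triple product
`{a, b, c} = (a b* c + c b* a) / 2`; morphisms of `Z` into TROs inside `B` are of this form. -/
structure JBRep [JBStarTriple Z] where
  B : Type w
  [cstar : NonUnitalCStarAlgebra B]
  hom : Z →L[ℂ] B
  map_tp : ∀ x y z : Z, hom (tp x y z) =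
    (1 / 2 : ℂ) • (hom x * star (hom y) * hom z + hom z * star (hom y) * hom x)

attribute [instance] JBRep.cstar

variable {Z}

theorem norm_cube_le {B : Type*} [NonUnitalCStarAlgebra B] (a : B) :
    ‖a‖ ^ 3 ≤ ‖a * star a * a‖ := by
  set h : B := star a * a with hh
  have hs : star h = h := by simp [hh]
  have n1 : ‖h‖ = ‖a‖ ^ 2 := by rw [hh, CStarRing.norm_star_mul_self, sq]
  have n2 : ‖h * h‖ = ‖h‖ ^ 2 := by
    conv_lhs => rw [← hs, hs]
    nth_rewrite 1 [← hs]
    rw [CStarRing.norm_star_mul_self, sq]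
  have n3 : ‖(h * h) * (h * h)‖ = ‖h * h‖ ^ 2 := by
    have : star (h * h) = h * h := by rw [star_mul, hs]
    nth_rewrite 1 [← this]
    rw [CStarRing.norm_star_mul_self, sq]
  have n4 : ‖(h * h) * (h * h)‖ ≤ ‖h * h * h‖ * ‖h‖ := by
    rw [← mul_assoc]; exact norm_mul_le _ _
  have n5 : ‖h * h * h‖ = ‖a * star a * a‖ ^ 2 := by
    rw [sq, ← CStarRing.norm_star_mul_self]
    congr 1
    simp only [hh, star_mul, star_star, mul_assoc]
  rcases eq_or_lt_of_le (norm_nonneg a) with h0 | h0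
  · rw [← h0]; simp
  · have hp : 0 < ‖h‖ := by rw [n1]; positivity
    have : ‖h‖ ^ 3 ≤ ‖h * h * h‖ := by
      rw [n3, n2] at n4
      refine le_of_mul_le_mul_right ?_ hp
      calc ‖h‖ ^ 3 * ‖h‖ = (‖h‖ ^ 2) ^ 2 := by ring
        _ ≤ _ := n4
    rw [n1, n5] at this
    refine le_of_sq_le_sq ?_ (norm_nonneg _)
    calc (‖a‖ ^ 3) ^ 2 = (‖a‖ ^ 2) ^ 3 := by ring
      _ ≤ _ := this

/-- JB*-morphisms are contractive. -/
theorem JBRep.norm_hom_le [JBStarTriple Z] (π : JBRep.{w} Z) (x : Z) : ‖π.hom x‖ ≤ ‖x‖ := by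
  have key : ∀ x, ‖π.hom x‖ ^ 3 ≤ ‖π.hom‖ * ‖x‖ ^ 3 := fun x => by
    have h := π.map_tp x x x
    rw [← two_smul ℂ, smul_smul] at h
    norm_num at h
    calc ‖π.hom x‖ ^ 3 ≤ ‖π.hom x * star (π.hom x) * π.hom x‖ := norm_cube_le _
      _ = ‖π.hom (tp x x x)‖ := by rw [h]
      _ ≤ ‖π.hom‖ * ‖tp x x x‖ := π.hom.le_opNorm _
      _ = _ := by rw [JBStarTriple.norm_tp_self]
  obtain ⟨c, hc0, hc⟩ : ∃ c : ℝ, 0 ≤ c ∧ c ^ 3 = ‖π.hom‖ :=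
    ⟨‖π.hom‖ ^ ((1 : ℝ) / 3), by positivity, by
      rw [← Real.rpow_natCast, ← Real.rpow_mul (norm_nonneg _)]; norm_num⟩
  have h1 : ‖π.hom‖ ≤ c := by
    refine π.hom.opNorm_le_bound hc0 fun y => ?_
    refine le_of_pow_le_pow_left₀ (n := 3) (by norm_num) (by positivity) ?_
    rw [mul_pow, hc]; exact key y
  have h2 : c ≤ 1 := by
    by_contra hlt
    push Not at hlt
    rw [← hc] at h1
    nlinarith [mul_pos (by linarith : 0 < c) (by linarith : 0 < c - 1)]
  calc ‖π.hom x‖ ≤ ‖π.hom‖ * ‖x‖ := π.hom.le_opNorm x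
    _ ≤ 1 * ‖x‖ := by gcongr; linarith
    _ = ‖x‖ := one_mul _

variable (Z)

/-- The `ℓ^∞`-product of the targets of all JB*-morphisms of `Z` into C*-algebras. -/
abbrev EnvAlg [JBStarTriple Z] : Type _ := lp (fun π : JBRep.{w} Z => π.B) ∞

variable {Z}

/-- The canonical map `ρ_Z`, `z ↦ (π z)_π`. -/
noncomputable def rho [JBStarTriple Z] (z : Z) : EnvAlg.{w} Z :=
  ⟨fun π => π.hom z, memℓp_infty ⟨‖z‖, by rintro _ ⟨π, rfl⟩; exact π.norm_hom_le z⟩⟩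

variable (Z)

/-- The universal enveloping TRO `T*(Z)`: the TRO generated by the image of `ρ_Z`. It has the
universal property that every JB*-morphism `π` of `Z` into a TRO `V` factors as `Φ ∘ ρ_Z` for a
unique TRO-morphism `Φ : T*(Z) → V`; here `Φ` is the `π`-th coordinate. -/
noncomputable def univTRO [JBStarTriple Z] : TRO (EnvAlg.{w} Z) :=
  TRO.generate (Set.range (rho.{w} (Z := Z)))

variable {Z}

theorem rho_mem [JBStarTriple Z] (z : Z) : rho.{w} z ∈ (univTRO.{w} Z).carrier :=
  TRO.subset_generate _ ⟨z, rfl⟩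

theorem rho_triple [JBStarTriple Z] (z : Z) :
    rho.{w} z * star (rho.{w} z) * rho.{w} z = rho.{w} (tp z z z) := by
  ext π
  change π.hom z * star (π.hom z) * π.hom z = π.hom (tp z z z)
  rw [π.map_tp, ← two_smul ℂ, smul_smul]
  norm_num

end Universal

/-! ### The `K₀`-group -/

section KTheory
variable {A : Type*} [NonUnitalRing A] [StarRing A]

/-- Murray-von Neumann equivalence of square matrices over `A`, of possibly different sizes. -/
def MvN {m n : Type*} [Fintype m] [Fintype n] (p : Matrix m m A) (q : Matrix n n A) : Prop :=
  ∃ v : Matrix n m A, vᴴ * v = p ∧ v * vᴴ = q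

namespace MvN
variable {m n k l : Type*} [Fintype m] [Fintype n] [Fintype k] [Fintype l]

theorem refl {p : Matrix m m A} (hp : IsStarProjection p) : MvN p p := by
  have h : pᴴ = p := hp.isSelfAdjoint
  exact ⟨p, by rw [h]; exact hp.isIdempotentElem, by rw [h]; exact hp.isIdempotentElem⟩

theorem symm {p : Matrix m m A} {q : Matrix n n A} (h : MvN p q) : MvN q p := by
  obtain ⟨v, h1, h2⟩ := h
  exact ⟨vᴴ, by simpa using h2, by simpa using h1⟩

theorem trans {p : Matrix m m A} {q : Matrix n n A} {r : Matrix k k A} (hp : IsStarProjection p)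
    (hr : IsStarProjection r) (h : MvN p q) (h' : MvN q r) : MvN p r := by
  obtain ⟨u, h1, h2⟩ := h
  obtain ⟨v, h3, h4⟩ := h'
  refine ⟨v * u, ?_, ?_⟩
  · calc (v * u)ᴴ * (v * u) = uᴴ * (vᴴ * v) * u := by
          rw [Matrix.conjTranspose_mul]; simp only [Matrix.mul_assoc]
      _ = (uᴴ * u) * (uᴴ * u) := by rw [h3, ← h2]; simp only [Matrix.mul_assoc]
      _ = p := by rw [h1]; exact hp.isIdempotentElem
  · calc (v * u) * (v * u)ᴴ = v * (u * uᴴ) * vᴴ := by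
          rw [Matrix.conjTranspose_mul]; simp only [Matrix.mul_assoc]
      _ = (v * vᴴ) * (v * vᴴ) := by rw [h2, ← h3]; simp only [Matrix.mul_assoc]
      _ = r := by rw [h4]; exact hr.isIdempotentElem

theorem submatrix {p : Matrix m m A} (hp : IsStarProjection p) (e : n ≃ m) :
    MvN p (p.submatrix e e) := by
  have h : pᴴ = p := hp.isSelfAdjoint
  have h' : p * p = p := hp.isIdempotentElem
  refine ⟨p.submatrix e id, ?_, ?_⟩
  · rw [Matrix.conjTranspose_submatrix, h, Matrix.submatrix_mul_equiv, h', Matrix.submatrix_id_id]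
  · rw [Matrix.conjTranspose_submatrix, h]
    have := Matrix.submatrix_mul_equiv p p (e : n → m) (Equiv.refl m) (e : n → m)
    rw [h'] at this
    exact this

theorem fromBlocks {p : Matrix m m A} {p' : Matrix k k A} {q : Matrix n n A} {q' : Matrix l l A}
    (h : MvN p p') (h' : MvN q q') :
    MvN (Matrix.fromBlocks p 0 0 q) (Matrix.fromBlocks p' 0 0 q') := by
  obtain ⟨u, rfl, rfl⟩ := h
  obtain ⟨v, rfl, rfl⟩ := h'
  refine ⟨Matrix.fromBlocks u 0 0 v, ?_, ?_⟩ <;>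
    simp [Matrix.fromBlocks_conjTranspose, Matrix.fromBlocks_multiply]

end MvN

theorem IsStarProjection.matrix_submatrix {m n : Type*} [Fintype m] [Fintype n] {p : Matrix m m A}
    (hp : IsStarProjection p) (e : n ≃ m) : IsStarProjection (p.submatrix e e) where
  isIdempotentElem := by
    change p.submatrix e e * p.submatrix e e = _
    rw [Matrix.submatrix_mul_equiv, hp.isIdempotentElem.eq]
  isSelfAdjoint := by
    change (p.submatrix e e)ᴴ = _
    rw [Matrix.conjTranspose_submatrix]
    exact congrArg (fun q => Matrix.submatrix q e e) hp.isSelfAdjoint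

theorem IsStarProjection.matrix_fromBlocks {m n : Type*} [Fintype m] [Fintype n]
    {p : Matrix m m A} {q : Matrix n n A}
    (hp : IsStarProjection p) (hq : IsStarProjection q) :
    IsStarProjection (Matrix.fromBlocks p 0 0 q) where
  isIdempotentElem := by
    have h1 : p * p = p := hp.isIdempotentElem
    have h2 : q * q = q := hq.isIdempotentElem
    change _ * _ = _
    simp [Matrix.fromBlocks_multiply, h1, h2]
  isSelfAdjoint := by
    have h1 : pᴴ = p := hp.isSelfAdjoint
    have h2 : qᴴ = q := hq.isSelfAdjoint
    change _ᴴ = _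
    simp [Matrix.fromBlocks_conjTranspose, h1, h2]

variable (A)

/-- Projections in the matrix algebras `M_n(A)`, `n ∈ ℕ`. -/
structure MatProj where
  n : ℕ
  p : Matrix (Fin n) (Fin n) A
  isProj : IsStarProjection p

variable {A}

namespace MatProj

/-- Murray-von Neumann equivalence. -/
instance setoid : Setoid (MatProj A) where
  r P Q := MvN P.p Q.p
  iseqv := ⟨fun P => MvN.refl P.isProj, fun h => h.symm,
    fun {P _ R} h h' => MvN.trans P.isProj R.isProj h h'⟩

/-- The direct sum `p ⊕ q`. -/
def sum (P Q : MatProj A) : MatProj A where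
  n := P.n + Q.n
  p := (Matrix.fromBlocks P.p 0 0 Q.p).submatrix finSumFinEquiv.symm finSumFinEquiv.symm
  isProj := (P.isProj.matrix_fromBlocks Q.isProj).matrix_submatrix _

theorem sum_equiv (P Q : MatProj A) : MvN (Matrix.fromBlocks P.p 0 0 Q.p) (P.sum Q).p :=
  MvN.submatrix (P.isProj.matrix_fromBlocks Q.isProj) _

/-- The empty matrix. -/
def zero : MatProj A where
  n := 0
  p := 0
  isProj := .zero _

/-- A projection of `A`, as a `1 × 1` matrix. -/
def ofProj (p : A) (hp : IsStarProjection p) : MatProj A where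
  n := 1
  p := Matrix.of fun _ _ => p
  isProj := by
    constructor
    · ext i j
      simp [Matrix.mul_apply, hp.isIdempotentElem.eq]
    · ext i j
      simp [Matrix.star_apply, hp.isSelfAdjoint.star_eq]

/-- The image of a matrix projection under a `*`-homomorphism. -/
def map {B : Type*} [NonUnitalRing B] [StarRing B] [Module ℂ A] [Module ℂ B]
    (f : A →⋆ₙₐ[ℂ] B) (P : MatProj A) : MatProj B where
  n := P.n
  p := P.p.map f
  isProj := by
    constructor
    · change P.p.map f * P.p.map f = _
      rw [← Matrix.map_mul, P.isProj.isIdempotentElem.eq]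
    · change (P.p.map f)ᴴ = _
      rw [← Matrix.conjTranspose_map f (fun a => map_star f a)]
      exact congrArg (fun q => Matrix.map q f) P.isProj.isSelfAdjoint

end MatProj

variable (A)

/-- The semigroup `V(A)` of Murray-von Neumann classes of projections in matrices over `A`. -/
def VMonoid : Type _ := Quotient (MatProj.setoid (A := A))

variable {A}

instance VMonoid.instAdd : Add (VMonoid A) where
  add := Quotient.map₂ MatProj.sum fun P P' h Q Q' h' =>
    ((MatProj.sum_equiv P Q).symm.trans (P.sum Q).isProj (P'.isProj.matrix_fromBlocks Q'.isProj)
      (MvN.fromBlocks h h')).trans (P.sum Q).isProj (P'.sum Q').isProj (MatProj.sum_equiv P' Q')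

instance VMonoid.instZero : Zero (VMonoid A) where
  zero := Quotient.mk _ MatProj.zero

instance VMonoid.instAddCommMonoid : AddCommMonoid (VMonoid A) where
  add_assoc x y z := by
    induction x using Quotient.inductionOn with | h P => ?_
    induction y using Quotient.inductionOn with | h Q => ?_
    induction z using Quotient.inductionOn with | h R => ?_
    refine Quotient.sound ?_
    change MvN ((P.sum Q).sum R).p (P.sum (Q.sum R)).p
    have h1 := P.isProj.matrix_fromBlocks Q.isProj
    have h2 := Q.isProj.matrix_fromBlocks R.isProj
    have a1 := ((P.sum Q).sum_equiv R).symm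
    have a2 := MvN.fromBlocks (P.sum_equiv Q).symm (MvN.refl R.isProj)
    have a3 := MvN.submatrix (h1.matrix_fromBlocks R.isProj) (Equiv.sumAssoc _ _ _).symm
    have e : (Matrix.fromBlocks (Matrix.fromBlocks P.p 0 0 Q.p) 0 0 R.p).submatrix
        (Equiv.sumAssoc _ _ _).symm (Equiv.sumAssoc _ _ _).symm =
        Matrix.fromBlocks P.p 0 0 (Matrix.fromBlocks Q.p 0 0 R.p) := by
      ext (i | i | i) (j | j | j) <;> rfl
    rw [e] at a3
    have a4 := MvN.fromBlocks (MvN.refl P.isProj) (Q.sum_equiv R)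
    have a5 := P.sum_equiv (Q.sum R)
    have p0 := ((P.sum Q).sum R).isProj
    have p3 := P.isProj.matrix_fromBlocks h2
    have p4 := P.isProj.matrix_fromBlocks (Q.sum R).isProj
    exact (((a1.trans p0 (h1.matrix_fromBlocks R.isProj) a2).trans p0 p3 a3).trans p0 p4 a4).trans
      p0 (P.sum (Q.sum R)).isProj a5
  add_comm x y := by
    induction x using Quotient.inductionOn with | h P => ?_
    induction y using Quotient.inductionOn with | h Q => ?_
    refine Quotient.sound ?_
    change MvN (P.sum Q).p (Q.sum P).p
    have a1 := (P.sum_equiv Q).symm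
    have a2 := MvN.submatrix (P.isProj.matrix_fromBlocks Q.isProj) (Equiv.sumComm _ _)
    have e : (Matrix.fromBlocks P.p 0 0 Q.p).submatrix (Equiv.sumComm _ _) (Equiv.sumComm _ _) =
        Matrix.fromBlocks Q.p 0 0 P.p := by
      ext (i | i) (j | j) <;> rfl
    rw [e] at a2
    exact (a1.trans (P.sum Q).isProj (Q.isProj.matrix_fromBlocks P.isProj) a2).trans
      (P.sum Q).isProj (Q.sum P).isProj (Q.sum_equiv P)
  zero_add x := by
    induction x using Quotient.inductionOn with | h P => ?_
    refine Quotient.sound ?_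
    change MvN (MatProj.zero.sum P).p P.p
    have a1 := (MatProj.zero.sum_equiv P).symm
    have : IsEmpty (Fin (MatProj.zero (A := A)).n) := Fin.isEmpty
    have a2 := MvN.submatrix ((MatProj.zero (A := A)).isProj.matrix_fromBlocks P.isProj)
      (Equiv.emptySum _ _).symm
    exact a1.trans (MatProj.zero.sum P).isProj P.isProj a2
  add_zero x := by
    induction x using Quotient.inductionOn with | h P => ?_
    refine Quotient.sound ?_
    change MvN (P.sum MatProj.zero).p P.p
    have a1 := (P.sum_equiv MatProj.zero).symm
    have : IsEmpty (Fin (MatProj.zero (A := A)).n) := Fin.isEmpty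
    have a2 := MvN.submatrix (P.isProj.matrix_fromBlocks (MatProj.zero (A := A)).isProj)
      (Equiv.sumEmpty _ _).symm
    exact a1.trans (P.sum MatProj.zero).isProj P.isProj a2
  nsmul := nsmulRec

/-- The homomorphism `V(A) → V(B)` induced by a `*`-homomorphism. -/
def VMonoid.map {B : Type*} [NonUnitalRing B] [StarRing B] [Module ℂ A] [Module ℂ B]
    (f : A →⋆ₙₐ[ℂ] B) : VMonoid A →+ VMonoid B where
  toFun := Quotient.map (MatProj.map f) fun P Q h => by
    obtain ⟨v, h1, h2⟩ := h
    refine ⟨v.map f, ?_, ?_⟩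
    · change (v.map f)ᴴ * v.map f = P.p.map f
      rw [← Matrix.conjTranspose_map f (fun a => map_star f a), ← Matrix.map_mul, h1]
    · change v.map f * (v.map f)ᴴ = Q.p.map f
      rw [← Matrix.conjTranspose_map f (fun a => map_star f a), ← Matrix.map_mul, h2]
  map_zero' := by
    refine congrArg (Quotient.mk _) ?_
    change MatProj.mk _ _ _ = MatProj.mk _ _ _
    congr
    ext i
    exact i.elim0
  map_add' x y := by
    induction x using Quotient.inductionOn with | h P => ?_
    induction y using Quotient.inductionOn with | h Q => ?_
    refine congrArg (Quotient.mk _) ?_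
    change MatProj.mk _ _ _ = MatProj.mk _ _ _
    congr
    change ((Matrix.fromBlocks P.p 0 0 Q.p).map f).submatrix _ _ = _
    rw [Matrix.fromBlocks_map, Matrix.map_zero _ (map_zero f), Matrix.map_zero _ (map_zero f)]
    rfl

variable (A)

/-- `K₀(A)`: the Grothendieck group of `V(A)`. This is the `K₀`-group of a unital C*-algebra `A`,
hence of every finite-dimensional one. -/
abbrev K0 : Type _ := Algebra.GrothendieckAddGroup (VMonoid A)

variable {A}

namespace K0

/-- The class of a matrix projection. -/
def mk (P : MatProj A) : K0 A := Algebra.GrothendieckAddGroup.of (Quotient.mk _ P : VMonoid A)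

/-- The class `[p]` of a projection `p ∈ A`. -/
def cls (p : A) (hp : IsStarProjection p) : K0 A := mk (MatProj.ofProj p hp)

/-- `K₀(f) : K₀(A) → K₀(B)`. -/
noncomputable def map {B : Type*} [NonUnitalRing B] [StarRing B] [Module ℂ A] [Module ℂ B]
    (f : A →⋆ₙₐ[ℂ] B) : K0 A →+ K0 B :=
  Algebra.GrothendieckAddGroup.lift
    ((Algebra.GrothendieckAddGroup.of (M := VMonoid B)).comp (VMonoid.map f))

variable (A)

/-- The positive cone `K₀(A)₊`: all classes of matrix projections. -/
def pos : Set (K0 A) := Set.range mk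

/-- The scale `Σ(A)`: all classes of projections of `A` itself. -/
def scale : Set (K0 A) := {x | ∃ (p : A) (hp : IsStarProjection p), x = cls p hp}

end K0

end KTheory

/-! ### The K-JB* invariant -/

/-- The data making up a K-JB* structure: a group with a positive cone, a left scale, a right
scale, and the set of classes of tripotents. -/
structure KJBData where
  K : Type u₁
  [group : AddCommGroup K]
  pos : Set K
  scaleL : Set K
  scaleR : Set K
  delta : Set K

attribute [instance] KJBData.group

/-- K-JB* morphisms. -/
structure IsKJBMorphism (X : KJBData.{u₁}) (Y : KJBData.{u₂}) (φ : X.K →+ Y.K) : Prop where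
  pos : φ '' X.pos ⊆ Y.pos
  scaleL : φ '' X.scaleL ⊆ Y.scaleL
  scaleR : φ '' X.scaleR ⊆ Y.scaleR
  delta : φ '' X.delta ⊆ Y.delta

/-- A K-JB* isomorphism: a group isomorphism which is a K-JB* morphism in both directions. -/
structure KJBIso (X : KJBData.{u₁}) (Y : KJBData.{u₂}) where
  equiv : X.K ≃+ Y.K
  isMorphism : IsKJBMorphism X Y equiv.toAddMonoidHom
  isMorphism_symm : IsKJBMorphism Y X equiv.symm.toAddMonoidHom

/-- The direct sum of K-JB* structures, formed componentwise. -/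
def KJBData.directSum (X : KJBData.{u₁}) (Y : KJBData.{u₂}) : KJBData.{max u₁ u₂} where
  K := X.K × Y.K
  pos := X.pos ×ˢ Y.pos
  scaleL := X.scaleL ×ˢ Y.scaleL
  scaleR := X.scaleR ×ˢ Y.scaleR
  delta := X.delta ×ˢ Y.delta

section Invariant
variable {Z : Type u₁} [NormedAddCommGroup Z] [NormedSpace ℂ Z] [CompleteSpace Z] [JBStarTriple Z]

/-- `ρ_Z(g) ρ_Z(g)*` as an element of `L(T*(Z))`. -/
noncomputable def suppElem (g : Z) : (univTRO.{w} Z).leftAlg :=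
  ⟨rho.{w} g * star (rho.{w} g), (univTRO.{w} Z).mul_star_mem_leftAlg (rho_mem g) (rho_mem g)⟩

theorem isStarProjection_suppElem {g : Z} (hg : tp g g g = g) :
    IsStarProjection (suppElem.{w} g) where
  isIdempotentElem := by
    refine Subtype.ext ?_
    change rho.{w} g * star (rho.{w} g) * (rho.{w} g * star (rho.{w} g)) =
      rho.{w} g * star (rho.{w} g)
    rw [← mul_assoc, rho_triple, hg]
  isSelfAdjoint := by
    refine Subtype.ext ?_
    change star (rho.{w} g * star (rho.{w} g)) = rho.{w} g * star (rho.{w} g)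
    simp

variable (Z)

/-- The K-JB* invariant of `Z`, on the group `K₀(L(T*(Z)))`. The right scale is the scale of
`R(T*(Z))`, transported to `K₀(L(T*(Z)))` through the `K₀`-group of the linking algebra by
`K₀(ι_L)⁻¹ K₀(ι_R)`. -/
noncomputable def KJB : KJBData where
  K := K0 (univTRO.{w} Z).leftAlg
  pos := K0.pos (univTRO.{w} Z).leftAlg
  scaleL := K0.scale (univTRO.{w} Z).leftAlg
  scaleR := K0.map (univTRO.{w} Z).leftIncl ⁻¹'
    (K0.map (univTRO.{w} Z).rightIncl '' K0.scale (univTRO.{w} Z).rightAlg)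
  delta := {x | ∃ (g : Z) (hg : tp g g g = g), x = K0.cls _ (isStarProjection_suppElem.{w} hg)}

end Invariant

/-!
The point is that `T*(Z₁ ⊕ Z₂) = T*(Z₁) ⊕ T*(Z₂)`, and that `K₀` and its scales respect direct sums.

If `π` is a JB*-morphism of `Z₁ × Z₂` into a C*-algebra, `x = π (z₁, 0)` and `y = π (0, z₂)`, then
`{(z₁, 0), (z₁, 0), (0, z₂)} = 0` gives `x x* y + y x* x = 0`, and positivity turns this into
`x* y = 0` and `x y* = 0` (`star_mul_eq_zero_of_triple_eq_zero`). So the two summands of `Z₁ × Z₂`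
generate orthogonal TROs. The enveloping C*-algebra `EnvAlg` is a covariant functor for bounded
triple homomorphisms (`EnvAlg.map`); the coordinate projections and embeddings of `Z₁ × Z₂` induce
`*`-homomorphisms which, restricted to the generated TROs, exhibit `T*(Z₁ × Z₂)` as the direct sum
of `T*(Z₁)` and `T*(Z₂)` (`univTRODirectSum`). The identities involved pass from generators to TROs,
and from TROs to their left and right algebras (`TRO.DirectSum.left`, `TRO.DirectSum.right`).

The functor `K₀` is additive on sums of `*`-homomorphisms with orthogonal ranges
(`K0.map_add_of_orthogonal`), so a decomposition `A = B ⊕ C` of `*`-algebras yields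
`K₀(A) ≃ K₀(B) × K₀(C)` (`StarDirectSum.k0Equiv`). A sum of two orthogonal projections is a
projection whose class is the sum of the classes, so positive cones and scales correspond. The right
scale is treated through the naturality of the corner embeddings into the linking algebra: it is
enough that `*`-homomorphisms between TROs induce compatible maps of left, right and linking
algebras. Finally, the tripotents of `Z₁ × Z₂` are the pairs of tripotents.
-/

/-! ### Orthogonality in C*-algebras -/

section Orthogonality
variable {B : Type*} [NonUnitalCStarAlgebra B]

/-- Triple-orthogonal elements of a C*-algebra are `*`-orthogonal on both sides. From
`x x* y = -y x* x` the element `y* x x* y ≥ 0` equals `-(y* y)(x* x)`; being self-adjoint, it is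
minus a product of commuting positive elements, so it vanishes. -/
theorem star_mul_eq_zero_of_triple_eq_zero {x y : B}
    (h : x * star x * y + y * star x * x = 0) : star x * y = 0 ∧ x * star y = 0 := by
  let _ : PartialOrder B := CStarAlgebra.spectralOrder B
  have _ : StarOrderedRing B := CStarAlgebra.spectralOrderedRing B
  have h1 : star y * x * star x * y = -(star y * y * (star x * x)) := by
    have := congrArg (star y * ·) h
    simp only [mul_add, mul_zero, ← mul_assoc] at this ⊢
    exact eq_neg_of_add_eq_zero_left this
  have e1 : star (star x * y) * (star x * y) = star y * x * star x * y := by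
    simp [mul_assoc]
  have hc : Commute (star y * y) (star x * x) := by
    have := congrArg star h1
    simp only [star_mul, star_star, star_neg, ← mul_assoc] at this h1
    rw [h1, neg_inj] at this
    simpa only [Commute, SemiconjBy, ← mul_assoc] using this
  have hn : 0 ≤ star y * y * (star x * x) :=
    Commute.mul_nonneg (star_mul_self_nonneg y) (star_mul_self_nonneg x) hc
  have hp : 0 ≤ star y * x * star x * y := e1 ▸ star_mul_self_nonneg (star x * y)
  have hz : star y * y * (star x * x) = 0 := by
    refine le_antisymm ?_ hn
    rwa [h1, Left.nonneg_neg_iff] at hp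
  have h2 : star x * y = 0 := by
    rw [← CStarRing.star_mul_self_eq_zero_iff, e1, h1, hz, neg_zero]
  refine ⟨h2, ?_⟩
  -- `y x* x = -x x* y = 0`, and then `(y x*)(y x*)* = 0`.
  have h3 : y * star x * x = 0 := by
    rw [mul_assoc x, h2, mul_zero, zero_add] at h
    exact h
  have h4 : y * star x = 0 := by
    rw [← CStarRing.mul_star_self_eq_zero_iff, star_mul, star_star, ← mul_assoc, h3, zero_mul]
  simpa using congrArg star h4

end Orthogonality

/-! ### Morphisms of ternary rings of operators -/

namespace TRO
variable {A B C : Type*} [NonUnitalCStarAlgebra A] [NonUnitalCStarAlgebra B]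
  [NonUnitalCStarAlgebra C]

theorem continuous_starHom (f : A →⋆ₙₐ[ℂ] B) : Continuous f := by
  open scoped CStarAlgebra in exact map_continuous f

/-- Induction on the TRO generated by a set. -/
theorem generate_induction {s : Set A} {p : A → Prop} (mem : ∀ x ∈ s, p x)
    (zero : p 0) (add : ∀ x y, p x → p y → p (x + y)) (smul : ∀ (c : ℂ) x, p x → p (c • x))
    (triple : ∀ x y z, p x → p y → p z → p (x * star y * z)) (closed : IsClosed {x | p x})
    {x : A} (hx : x ∈ (generate s).carrier) : p x :=
  hx { carrier := {x | p x}
       add_mem' := fun {x y} => add x y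
       zero_mem' := zero
       smul_mem' := fun c x => smul c x
       isClosed' := closed
       triple_mem' := fun {x y z} => triple x y z } mem

/-- Two `*`-homomorphisms agreeing on `s` agree on the TRO generated by `s`. -/
theorem eqOn_generate {s : Set A} {f g : A →⋆ₙₐ[ℂ] B} (h : ∀ x ∈ s, f x = g x) {x : A}
    (hx : x ∈ (generate s).carrier) : f x = g x :=
  generate_induction (p := fun x => f x = g x) h (by simp) (fun x y h1 h2 => by simp [h1, h2])
    (fun c x h1 => by simp [h1]) (fun x y z h1 h2 h3 => by simp [h1, h2, h3, map_star])
    (isClosed_eq (continuous_starHom f) (continuous_starHom g)) hx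

/-- A `*`-homomorphism maps the TRO generated by `s` into every TRO containing the image of `s`. -/
theorem map_mem_of_generate {s : Set A} {S : TRO B} (f : A →⋆ₙₐ[ℂ] B)
    (h : ∀ x ∈ s, f x ∈ S.carrier) {x : A} (hx : x ∈ (generate s).carrier) : f x ∈ S.carrier :=
  generate_induction (p := fun x => f x ∈ S.carrier) h (by simp)
    (fun x y h1 h2 => by simpa using S.add_mem h1 h2)
    (fun c x h1 => by simpa using S.smul_mem c h1)
    (fun x y z h1 h2 h3 => by simpa [map_star] using S.triple_mem' h1 h2 h3)
    (S.isClosed'.preimage (continuous_starHom f)) hx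

/-- If two `*`-homomorphisms have `*`-orthogonal values on generators, then they have
`*`-orthogonal values on the generated TROs. -/
theorem orthogonal_of_generate {s : Set A} {t : Set B} (f : A →⋆ₙₐ[ℂ] C) (g : B →⋆ₙₐ[ℂ] C)
    (h : ∀ x ∈ s, ∀ y ∈ t, star (f x) * g y = 0 ∧ f x * star (g y) = 0)
    {x : A} (hx : x ∈ (generate s).carrier) {y : B} (hy : y ∈ (generate t).carrier) :
    star (f x) * g y = 0 ∧ f x * star (g y) = 0 := by
  have c1 := continuous_starHom f
  have c2 := continuous_starHom g
  have h' : ∀ x ∈ s, star (f x) * g y = 0 ∧ f x * star (g y) = 0 := fun x hx => by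
    refine generate_induction (p := fun y => star (f x) * g y = 0 ∧ f x * star (g y) = 0)
      (h x hx) (by simp) ?_ ?_ ?_ ?_ hy
    · rintro y z ⟨h1, h2⟩ ⟨h3, h4⟩
      simp [mul_add, h1, h2, h3, h4]
    · rintro c y ⟨h1, h2⟩
      simp [mul_smul_comm, h1, h2]
    · rintro y z t ⟨h1, -⟩ - ⟨-, h2⟩
      simp only [map_mul, star_mul]
      exact ⟨by rw [← mul_assoc, ← mul_assoc, h1, zero_mul, zero_mul],
        by rw [← mul_assoc, h2, zero_mul]⟩
    · exact (isClosed_eq (by fun_prop) continuous_const).inter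
        (isClosed_eq (by fun_prop) continuous_const)
  refine generate_induction (p := fun x => star (f x) * g y = 0 ∧ f x * star (g y) = 0)
    h' (by simp) ?_ ?_ ?_ ?_ hx
  · rintro x z ⟨h1, h2⟩ ⟨h3, h4⟩
    simp [add_mul, h1, h2, h3, h4]
  · rintro c x ⟨h1, h2⟩
    simp [smul_mul_assoc, h1, h2]
  · rintro x z t ⟨h1, -⟩ - ⟨-, h2⟩
    simp only [map_mul, star_mul]
    exact ⟨by rw [mul_assoc, mul_assoc, h1, mul_zero, mul_zero],
      by rw [mul_assoc, h2, mul_zero]⟩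
  · exact (isClosed_eq (by fun_prop) continuous_const).inter
      (isClosed_eq (by fun_prop) continuous_const)

theorem leftAlg_induction {T : TRO A} {p : A → Prop}
    (mem : ∀ x ∈ T.carrier, ∀ y ∈ T.carrier, p (x * star y))
    (zero : p 0) (add : ∀ x y, p x → p y → p (x + y)) (smul : ∀ (c : ℂ) x, p x → p (c • x))
    (closed : IsClosed {x | p x}) {x : A} (hx : x ∈ T.leftAlg) : p x := by
  refine closure_minimal (s := (Submodule.span ℂ {a : A | ∃ x ∈ T.carrier, ∃ y ∈ T.carrier,
    a = x * star y} : Set A)) (fun b hb => ?_) closed hx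
  change b ∈ Submodule.span ℂ _ at hb
  induction hb using Submodule.span_induction with
  | mem b hb => obtain ⟨x, hx, y, hy, rfl⟩ := hb; exact mem x hx y hy
  | zero => exact zero
  | add y z _ _ h1 h2 => exact add y z h1 h2
  | smul c y _ h1 => exact smul c y h1

theorem rightAlg_induction {T : TRO A} {p : A → Prop}
    (mem : ∀ x ∈ T.carrier, ∀ y ∈ T.carrier, p (star x * y))
    (zero : p 0) (add : ∀ x y, p x → p y → p (x + y)) (smul : ∀ (c : ℂ) x, p x → p (c • x))
    (closed : IsClosed {x | p x}) {x : A} (hx : x ∈ T.rightAlg) : p x := by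
  refine closure_minimal (s := (Submodule.span ℂ {a : A | ∃ x ∈ T.carrier, ∃ y ∈ T.carrier,
    a = star x * y} : Set A)) (fun b hb => ?_) closed hx
  change b ∈ Submodule.span ℂ _ at hb
  induction hb using Submodule.span_induction with
  | mem b hb => obtain ⟨x, hx, y, hy, rfl⟩ := hb; exact mem x hx y hy
  | zero => exact zero
  | add y z _ _ h1 h2 => exact add y z h1 h2
  | smul c y _ h1 => exact smul c y h1

/-- Two `*`-homomorphisms agreeing on `T` agree on `L(T)`. -/
theorem eqOn_leftAlg {T : TRO A} {f g : A →⋆ₙₐ[ℂ] B} (h : ∀ x ∈ T.carrier, f x = g x) {a : A}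
    (ha : a ∈ T.leftAlg) : f a = g a :=
  leftAlg_induction (p := fun a => f a = g a)
    (fun x hx y hy => by simp [map_star, h x hx, h y hy]) (by simp)
    (fun x y h1 h2 => by simp [h1, h2]) (fun c x h1 => by simp [h1])
    (isClosed_eq (continuous_starHom f) (continuous_starHom g)) ha

/-- Two `*`-homomorphisms agreeing on `T` agree on `R(T)`. -/
theorem eqOn_rightAlg {T : TRO A} {f g : A →⋆ₙₐ[ℂ] B} (h : ∀ x ∈ T.carrier, f x = g x) {a : A}
    (ha : a ∈ T.rightAlg) : f a = g a :=
  rightAlg_induction (p := fun a => f a = g a)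
    (fun x hx y hy => by simp [map_star, h x hx, h y hy]) (by simp)
    (fun x y h1 h2 => by simp [h1, h2]) (fun c x h1 => by simp [h1])
    (isClosed_eq (continuous_starHom f) (continuous_starHom g)) ha

section Functoriality
variable {S : TRO A} {T : TRO B} (f : A →⋆ₙₐ[ℂ] B)

theorem map_mem_leftAlg (hf : ∀ x ∈ S.carrier, f x ∈ T.carrier) {a : A} (ha : a ∈ S.leftAlg) :
    f a ∈ T.leftAlg :=
  leftAlg_induction (p := fun a => f a ∈ T.leftAlg)
    (fun x hx y hy => by
      simpa [map_star] using T.mul_star_mem_leftAlg (hf x hx) (hf y hy))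
    (by simp) (fun x y h1 h2 => by simpa using add_mem h1 h2)
    (fun c x h1 => by simpa using SMulMemClass.smul_mem c h1)
    ((Submodule.isClosed_topologicalClosure _).preimage (continuous_starHom f)) ha

theorem map_mem_rightAlg (hf : ∀ x ∈ S.carrier, f x ∈ T.carrier) {a : A} (ha : a ∈ S.rightAlg) :
    f a ∈ T.rightAlg :=
  rightAlg_induction (p := fun a => f a ∈ T.rightAlg)
    (fun x hx y hy => by
      simpa [map_star] using T.star_mul_mem_rightAlg (hf x hx) (hf y hy))
    (by simp) (fun x y h1 h2 => by simpa using add_mem h1 h2)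
    (fun c x h1 => by simpa using SMulMemClass.smul_mem c h1)
    ((Submodule.isClosed_topologicalClosure _).preimage (continuous_starHom f)) ha

/-- The `*`-homomorphism `L(S) → L(T)` induced by a `*`-homomorphism mapping `S` into `T`. -/
def leftMap (hf : ∀ x ∈ S.carrier, f x ∈ T.carrier) : S.leftAlg →⋆ₙₐ[ℂ] T.leftAlg where
  toFun a := ⟨f a, map_mem_leftAlg f hf a.2⟩
  map_smul' c a := Subtype.ext (map_smul f c (a : A))
  map_zero' := Subtype.ext (map_zero f)
  map_add' a b := Subtype.ext (map_add f (a : A) b)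
  map_mul' a b := Subtype.ext (map_mul f (a : A) b)
  map_star' a := Subtype.ext (map_star f (a : A))

/-- The `*`-homomorphism `R(S) → R(T)` induced by a `*`-homomorphism mapping `S` into `T`. -/
def rightMap (hf : ∀ x ∈ S.carrier, f x ∈ T.carrier) : S.rightAlg →⋆ₙₐ[ℂ] T.rightAlg where
  toFun a := ⟨f a, map_mem_rightAlg f hf a.2⟩
  map_smul' c a := Subtype.ext (map_smul f c (a : A))
  map_zero' := Subtype.ext (map_zero f)
  map_add' a b := Subtype.ext (map_add f (a : A) b)
  map_mul' a b := Subtype.ext (map_mul f (a : A) b)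
  map_star' a := Subtype.ext (map_star f (a : A))

/-- The `*`-homomorphism `Li(S) → Li(T)` of linking algebras, acting entrywise, induced by a
`*`-homomorphism mapping `S` into `T`. -/
def linkingMap (hf : ∀ x ∈ S.carrier, f x ∈ T.carrier) : S.linkingAlg →⋆ₙₐ[ℂ] T.linkingAlg where
  toFun M := ⟨(M : Matrix (Fin 2) (Fin 2) A).map f, map_mem_leftAlg f hf M.2.1, hf _ M.2.2.1,
    by
      change star (f _) ∈ _
      rw [← map_star]
      exact hf _ M.2.2.2.1, map_mem_rightAlg f hf M.2.2.2.2⟩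
  map_smul' c M := by
    ext i j; exact map_smul f c ((M : Matrix (Fin 2) (Fin 2) A) i j)
  map_zero' := by
    ext i j; exact map_zero f
  map_add' M N := by
    ext i j
    exact map_add f ((M : Matrix (Fin 2) (Fin 2) A) i j) ((N : Matrix (Fin 2) (Fin 2) A) i j)
  map_mul' M N := Subtype.ext Matrix.map_mul
  map_star' M := by
    ext i j; exact map_star f ((M : Matrix (Fin 2) (Fin 2) A) j i)

theorem linkingMap_comp_leftIncl (hf : ∀ x ∈ S.carrier, f x ∈ T.carrier) :
    (linkingMap f hf).comp S.leftIncl = T.leftIncl.comp (leftMap f hf) := by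
  ext a i j
  fin_cases i <;> fin_cases j <;> simp [linkingMap, leftMap, leftIncl]

theorem linkingMap_comp_rightIncl (hf : ∀ x ∈ S.carrier, f x ∈ T.carrier) :
    (linkingMap f hf).comp S.rightIncl = T.rightIncl.comp (rightMap f hf) := by
  ext a i j
  fin_cases i <;> fin_cases j <;> simp [linkingMap, rightMap, rightIncl]

end Functoriality

end TRO

/-! ### `K₀` of orthogonal sums of `*`-homomorphisms -/

section KTheory
variable {A : Type*} [NonUnitalRing A] [StarRing A]

/-- The sum of two orthogonal projections is equivalent to their block diagonal sum, through the
row `(e f)`. -/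
theorem MvN.fromBlocks_add {n : Type*} [Fintype n] {e f : Matrix n n A}
    (he : IsStarProjection e) (hf : IsStarProjection f) (hef : e * f = 0) :
    MvN (Matrix.fromBlocks e 0 0 f) (e + f) := by
  have e1 : eᴴ = e := he.isSelfAdjoint
  have f1 : fᴴ = f := hf.isSelfAdjoint
  have e2 : e * e = e := he.isIdempotentElem
  have f2 : f * f = f := hf.isIdempotentElem
  have hfe : f * e = 0 := by
    have := congrArg Matrix.conjTranspose hef
    rwa [Matrix.conjTranspose_mul, e1, f1, Matrix.conjTranspose_zero] at this
  refine ⟨Matrix.fromCols e f, ?_, ?_⟩ <;>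
    rw [Matrix.conjTranspose_fromCols_eq_fromRows_conjTranspose, e1, f1]
  · ext (i | i) (j | j)
    · exact congrFun (congrFun e2 i) j
    · exact congrFun (congrFun hef i) j
    · exact congrFun (congrFun hfe i) j
    · exact congrFun (congrFun f2 i) j
  · calc Matrix.fromCols e f * Matrix.fromRows e f = e * e + f * f := by
          ext i j
          simp [Matrix.mul_apply]
      _ = e + f := by rw [e2, f2]

namespace K0

/-- Homomorphisms on `K₀(A)` are determined by the classes of matrix projections. -/
theorem hom_ext {G : Type*} [AddCommGroup G] {φ ψ : K0 A →+ G} (h : ∀ P, φ (mk P) = ψ (mk P)) :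
    φ = ψ := by
  refine Algebra.GrothendieckAddGroup.lift.symm.injective ?_
  ext x
  induction x using Quotient.inductionOn with | h P => ?_
  exact h P

theorem mk_add_mk (P Q : MatProj A) : mk P + mk Q = mk (P.sum Q) :=
  (AddMonoidHom.map_add (Algebra.GrothendieckAddGroup.of (M := VMonoid A)) (Quotient.mk _ P)
    (Quotient.mk _ Q)).symm

theorem mk_eq_mk {P Q : MatProj A} (h : MvN P.p Q.p) : mk P = mk Q :=
  congrArg Algebra.GrothendieckAddGroup.of (Quotient.sound h : (Quotient.mk _ P : VMonoid A) = _)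

/-- The class of a sum of orthogonal projections. -/
theorem cls_add_cls {p q r : A} (hp : IsStarProjection p) (hq : IsStarProjection q)
    (hr : IsStarProjection r) (hpq : p * q = 0) (h : p + q = r) :
    cls p hp + cls q hq = cls r hr := by
  subst h
  rw [cls, cls, mk_add_mk]
  have pp : IsStarProjection (Matrix.of fun _ _ : Fin 1 => p) := (MatProj.ofProj p hp).isProj
  have pq : IsStarProjection (Matrix.of fun _ _ : Fin 1 => q) := (MatProj.ofProj q hq).isProj
  have hm := MvN.fromBlocks_add pp pq (by
    ext i j
    simp [Matrix.mul_apply, hpq])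
  exact mk_eq_mk ((MatProj.sum_equiv _ _).symm.trans
    ((MatProj.ofProj p hp).sum (MatProj.ofProj q hq)).isProj (MatProj.ofProj _ hr).isProj hm)

end K0

variable [Module ℂ A]
variable {B : Type*} [NonUnitalRing B] [StarRing B] [Module ℂ B]
variable {C : Type*} [NonUnitalRing C] [StarRing C] [Module ℂ C]

namespace K0

theorem map_mk (f : A →⋆ₙₐ[ℂ] B) (P : MatProj A) : map f (mk P) = mk (P.map f) := by
  have h := Algebra.GrothendieckAddGroup.lift.symm_apply_apply
    ((Algebra.GrothendieckAddGroup.of (M := VMonoid B)).comp (VMonoid.map f))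
  exact DFunLike.congr_fun h (Quotient.mk _ P : VMonoid A)

theorem map_cls (f : A →⋆ₙₐ[ℂ] B) (p : A) (hp : IsStarProjection p) :
    map f (cls p hp) = cls (f p) (hp.map f) := map_mk f _

theorem map_id : map (NonUnitalStarAlgHom.id ℂ A) = AddMonoidHom.id (K0 A) :=
  hom_ext fun P => map_mk _ P

theorem map_comp (g : B →⋆ₙₐ[ℂ] C) (f : A →⋆ₙₐ[ℂ] B) : map (g.comp f) = (map g).comp (map f) :=
  hom_ext fun P => by rw [AddMonoidHom.comp_apply, map_mk, map_mk, map_mk]; rfl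

/-- If `h = f + g` for `*`-homomorphisms with orthogonal ranges, then `K₀(h) = K₀(f) + K₀(g)`. -/
theorem map_add_of_orthogonal {f g h : A →⋆ₙₐ[ℂ] B} (hfg : ∀ a b, f a * g b = 0)
    (hh : ∀ a, f a + g a = h a) : map h = map f + map g := by
  refine hom_ext fun P => ?_
  rw [AddMonoidHom.add_apply, map_mk, map_mk, map_mk, mk_add_mk]
  have pf : IsStarProjection (P.p.map f) := (P.map f).isProj
  have pg : IsStarProjection (P.p.map g) := (P.map g).isProj
  have horth : P.p.map f * P.p.map g = 0 := by
    ext i j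
    simp [Matrix.mul_apply, hfg]
  have hsum : P.p.map f + P.p.map g = P.p.map h := by
    ext i j
    exact hh _
  have hm := MvN.fromBlocks_add pf pg horth
  rw [hsum] at hm
  exact mk_eq_mk (hm.symm.trans (P.map h).isProj ((P.map f).sum (P.map g)).isProj
    (MatProj.sum_equiv _ _))

theorem map_eq_zero {f : A →⋆ₙₐ[ℂ] B} (hf : ∀ a, f a = 0) : map f = 0 := by
  have := map_add_of_orthogonal (f := f) (g := f) (h := f) (by simp [hf]) (by simp [hf])
  simpa using this

end K0

/-- A decomposition of the `*`-algebra `A` as the direct sum of `B` and `C`, given by its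
coordinate projections `fst`, `snd` and its coordinate embeddings `inl`, `inr`. -/
structure StarDirectSum (A B C : Type*) [NonUnitalRing A] [StarRing A] [Module ℂ A]
    [NonUnitalRing B] [StarRing B] [Module ℂ B] [NonUnitalRing C] [StarRing C] [Module ℂ C] where
  fst : A →⋆ₙₐ[ℂ] B
  snd : A →⋆ₙₐ[ℂ] C
  inl : B →⋆ₙₐ[ℂ] A
  inr : C →⋆ₙₐ[ℂ] A
  fst_inl : ∀ b, fst (inl b) = b
  fst_inr : ∀ c, fst (inr c) = 0
  snd_inl : ∀ b, snd (inl b) = 0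
  snd_inr : ∀ c, snd (inr c) = c
  inl_fst_add_inr_snd : ∀ a, inl (fst a) + inr (snd a) = a

namespace StarDirectSum
variable (D : StarDirectSum A B C)

theorem ext_of_components {a a' : A} (h : D.fst a = D.fst a') (h' : D.snd a = D.snd a') :
    a = a' := by
  rw [← D.inl_fst_add_inr_snd a, h, h', D.inl_fst_add_inr_snd]

theorem inl_mul_inr (b : B) (c : C) : D.inl b * D.inr c = 0 :=
  D.ext_of_components (by simp [D.fst_inr]) (by simp [D.snd_inl])

theorem isStarProjection_add {p : B} {q : C} (hp : IsStarProjection p) (hq : IsStarProjection q) :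
    IsStarProjection (D.inl p + D.inr q) where
  isIdempotentElem := D.ext_of_components
    (by simp [D.fst_inl, D.fst_inr, hp.isIdempotentElem.eq])
    (by simp [D.snd_inl, D.snd_inr, hq.isIdempotentElem.eq])
  isSelfAdjoint := by
    rw [IsSelfAdjoint, star_add, ← map_star, ← map_star, hp.isSelfAdjoint.star_eq,
      hq.isSelfAdjoint.star_eq]

theorem map_inl_cls_add_map_inr_cls {p : B} {q : C} (hp : IsStarProjection p)
    (hq : IsStarProjection q) : K0.map D.inl (K0.cls p hp) + K0.map D.inr (K0.cls q hq) =
      K0.cls (D.inl p + D.inr q) (D.isStarProjection_add hp hq) := by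
  rw [K0.map_cls, K0.map_cls]
  exact K0.cls_add_cls _ _ _ (D.inl_mul_inr p q) rfl

/-- `K₀(B ⊕ C) ≃ K₀(B) × K₀(C)`. -/
noncomputable def k0Equiv : K0 A ≃+ K0 B × K0 C :=
  AddMonoidHom.toAddEquiv ((K0.map D.fst).prod (K0.map D.snd))
    ((K0.map D.inl).coprod (K0.map D.inr))
    (by
      refine AddMonoidHom.ext fun x => ?_
      have h := K0.map_add_of_orthogonal (f := D.inl.comp D.fst) (g := D.inr.comp D.snd)
        (h := NonUnitalStarAlgHom.id ℂ A) (fun a b => D.inl_mul_inr _ _) D.inl_fst_add_inr_snd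
      rw [K0.map_id, K0.map_comp, K0.map_comp] at h
      exact (DFunLike.congr_fun h x).symm)
    (by
      have h11 : (K0.map D.fst).comp (K0.map D.inl) = AddMonoidHom.id _ := by
        rw [← K0.map_comp, ← K0.map_id]
        exact congrArg K0.map (NonUnitalStarAlgHom.ext D.fst_inl)
      have h22 : (K0.map D.snd).comp (K0.map D.inr) = AddMonoidHom.id _ := by
        rw [← K0.map_comp, ← K0.map_id]
        exact congrArg K0.map (NonUnitalStarAlgHom.ext D.snd_inr)
      have h12 : (K0.map D.fst).comp (K0.map D.inr) = 0 := by
        rw [← K0.map_comp]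
        exact K0.map_eq_zero D.fst_inr
      have h21 : (K0.map D.snd).comp (K0.map D.inl) = 0 := by
        rw [← K0.map_comp]
        exact K0.map_eq_zero D.snd_inl
      refine AddMonoidHom.ext fun ⟨x, y⟩ => Prod.ext ?_ ?_
      · change K0.map D.fst (K0.map D.inl x + K0.map D.inr y) = x
        rw [map_add]
        exact (congrArg₂ (· + ·) (DFunLike.congr_fun h11 x) (DFunLike.congr_fun h12 y)).trans
          (add_zero x)
      · change K0.map D.snd (K0.map D.inl x + K0.map D.inr y) = y
        rw [map_add]
        exact (congrArg₂ (· + ·) (DFunLike.congr_fun h21 x) (DFunLike.congr_fun h22 y)).trans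
          (zero_add y))

end StarDirectSum

end KTheory

/-! ### Direct sums of ternary rings of operators -/

namespace TRO
variable {A B C : Type*} [NonUnitalCStarAlgebra A] [NonUnitalCStarAlgebra B]
  [NonUnitalCStarAlgebra C]

/-- A decomposition of the TRO `T` as the direct sum of `T₁` and `T₂`, implemented by
`*`-homomorphisms of the ambient C*-algebras: the coordinate projections `fst`, `snd` and the
coordinate embeddings `inl`, `inr`, the latter having `*`-orthogonal ranges on `T₁` and `T₂`. The
identities are required on the TROs only. -/
structure DirectSum (T : TRO A) (T₁ : TRO B) (T₂ : TRO C) where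
  fst : A →⋆ₙₐ[ℂ] B
  snd : A →⋆ₙₐ[ℂ] C
  inl : B →⋆ₙₐ[ℂ] A
  inr : C →⋆ₙₐ[ℂ] A
  fst_mem : ∀ x ∈ T.carrier, fst x ∈ T₁.carrier
  snd_mem : ∀ x ∈ T.carrier, snd x ∈ T₂.carrier
  inl_mem : ∀ x ∈ T₁.carrier, inl x ∈ T.carrier
  inr_mem : ∀ x ∈ T₂.carrier, inr x ∈ T.carrier
  fst_inl : ∀ x ∈ T₁.carrier, fst (inl x) = x
  fst_inr : ∀ x ∈ T₂.carrier, fst (inr x) = 0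
  snd_inl : ∀ x ∈ T₁.carrier, snd (inl x) = 0
  snd_inr : ∀ x ∈ T₂.carrier, snd (inr x) = x
  orthogonal : ∀ x ∈ T₁.carrier, ∀ y ∈ T₂.carrier,
    star (inl x) * inr y = 0 ∧ inl x * star (inr y) = 0
  inl_fst_add_inr_snd : ∀ x ∈ T.carrier, inl (fst x) + inr (snd x) = x

/-- The identity `inl ∘ fst + inr ∘ snd = id` passes from generators to the generated TRO. -/
theorem inl_fst_add_inr_snd_of_generate {s : Set A} {T₁ : TRO B} {T₂ : TRO C}
    (fst : A →⋆ₙₐ[ℂ] B) (snd : A →⋆ₙₐ[ℂ] C) (inl : B →⋆ₙₐ[ℂ] A) (inr : C →⋆ₙₐ[ℂ] A)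
    (hfst : ∀ x ∈ s, fst x ∈ T₁.carrier) (hsnd : ∀ x ∈ s, snd x ∈ T₂.carrier)
    (orth : ∀ x ∈ T₁.carrier, ∀ y ∈ T₂.carrier,
      star (inl x) * inr y = 0 ∧ inl x * star (inr y) = 0)
    (h : ∀ x ∈ s, inl (fst x) + inr (snd x) = x) {x : A} (hx : x ∈ (generate s).carrier) :
    inl (fst x) + inr (snd x) = x := by
  have c1 := continuous_starHom fst
  have c2 := continuous_starHom snd
  have c3 := continuous_starHom inl
  have c4 := continuous_starHom inr
  -- The membership of the components is carried along, as orthogonality is needed for products.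
  refine (generate_induction (p := fun x => (fst x ∈ T₁.carrier ∧ snd x ∈ T₂.carrier) ∧
    inl (fst x) + inr (snd x) = x) (fun x hx => ⟨⟨hfst x hx, hsnd x hx⟩, h x hx⟩)
    (by simp) ?_ ?_ ?_ ?_ hx).2
  · rintro x y ⟨⟨h1, h2⟩, h3⟩ ⟨⟨h4, h5⟩, h6⟩
    refine ⟨⟨by simpa using T₁.add_mem h1 h4, by simpa using T₂.add_mem h2 h5⟩, ?_⟩
    conv_rhs => rw [← h3, ← h6]
    simp only [map_add]
    abel
  · rintro c x ⟨⟨h1, h2⟩, h3⟩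
    refine ⟨⟨by simpa using T₁.smul_mem c h1, by simpa using T₂.smul_mem c h2⟩, ?_⟩
    conv_rhs => rw [← h3]
    simp only [map_smul, smul_add]
  · rintro x y z ⟨⟨h1, h2⟩, h3⟩ ⟨⟨h4, h5⟩, h6⟩ ⟨⟨h7, h8⟩, h9⟩
    refine ⟨⟨by simpa [map_star] using T₁.triple_mem' h1 h4 h7,
      by simpa [map_star] using T₂.triple_mem' h2 h5 h8⟩, ?_⟩
    have o1 := (orth _ h1 _ h5).2
    have o2 := (orth _ h4 _ h8).1
    have o3 : inr (snd x) * star (inl (fst y)) = 0 := by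
      simpa using congrArg star (orth _ h4 _ h2).2
    have o4 : star (inr (snd y)) * inl (fst z) = 0 := by
      simpa using congrArg star (orth _ h7 _ h5).1
    conv_rhs => rw [← h3, ← h6, ← h9]
    simp only [map_mul, map_star, star_add, mul_add, add_mul, o1, o3, add_zero, zero_add]
    simp only [mul_assoc, o2, o4, mul_zero, add_zero, zero_add]
  · exact ((T₁.isClosed'.preimage c1).inter (T₂.isClosed'.preimage c2)).inter
      (isClosed_eq (by fun_prop) continuous_id)

namespace DirectSum
variable {T : TRO A} {T₁ : TRO B} {T₂ : TRO C} (D : DirectSum T T₁ T₂)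

/-- `L(T₁ ⊕ T₂) = L(T₁) ⊕ L(T₂)`. -/
def left : StarDirectSum T.leftAlg T₁.leftAlg T₂.leftAlg where
  fst := leftMap D.fst D.fst_mem
  snd := leftMap D.snd D.snd_mem
  inl := leftMap D.inl D.inl_mem
  inr := leftMap D.inr D.inr_mem
  fst_inl b := Subtype.ext <| eqOn_leftAlg (f := D.fst.comp D.inl)
    (g := NonUnitalStarAlgHom.id ℂ B) D.fst_inl b.2
  fst_inr c := Subtype.ext <| eqOn_leftAlg (f := D.fst.comp D.inr) (g := 0) D.fst_inr c.2
  snd_inl b := Subtype.ext <| eqOn_leftAlg (f := D.snd.comp D.inl) (g := 0) D.snd_inl b.2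
  snd_inr c := Subtype.ext <| eqOn_leftAlg (f := D.snd.comp D.inr)
    (g := NonUnitalStarAlgHom.id ℂ C) D.snd_inr c.2
  inl_fst_add_inr_snd a := by
    have c1 := continuous_starHom D.fst
    have c2 := continuous_starHom D.snd
    have c3 := continuous_starHom D.inl
    have c4 := continuous_starHom D.inr
    refine Subtype.ext <| leftAlg_induction
      (p := fun a => D.inl (D.fst a) + D.inr (D.snd a) = a) ?_ (by simp) ?_ ?_ ?_ a.2
    · intro x hx y hy
      have o1 := (D.orthogonal _ (D.fst_mem x hx) _ (D.snd_mem y hy)).2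
      have o2 : D.inr (D.snd x) * star (D.inl (D.fst y)) = 0 := by
        simpa using congrArg star (D.orthogonal _ (D.fst_mem y hy) _ (D.snd_mem x hx)).2
      conv_rhs => rw [← D.inl_fst_add_inr_snd x hx, ← D.inl_fst_add_inr_snd y hy]
      simp only [map_mul, map_star, star_add, mul_add, add_mul, o1, o2, add_zero, zero_add]
    · intro x y h1 h2
      conv_rhs => rw [← h1, ← h2]
      simp only [map_add]
      abel
    · intro c x h1
      conv_rhs => rw [← h1]
      simp only [map_smul, smul_add]
    · exact isClosed_eq (by fun_prop) continuous_id

/-- `R(T₁ ⊕ T₂) = R(T₁) ⊕ R(T₂)`. -/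
def right : StarDirectSum T.rightAlg T₁.rightAlg T₂.rightAlg where
  fst := rightMap D.fst D.fst_mem
  snd := rightMap D.snd D.snd_mem
  inl := rightMap D.inl D.inl_mem
  inr := rightMap D.inr D.inr_mem
  fst_inl b := Subtype.ext <| eqOn_rightAlg (f := D.fst.comp D.inl)
    (g := NonUnitalStarAlgHom.id ℂ B) D.fst_inl b.2
  fst_inr c := Subtype.ext <| eqOn_rightAlg (f := D.fst.comp D.inr) (g := 0) D.fst_inr c.2
  snd_inl b := Subtype.ext <| eqOn_rightAlg (f := D.snd.comp D.inl) (g := 0) D.snd_inl b.2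
  snd_inr c := Subtype.ext <| eqOn_rightAlg (f := D.snd.comp D.inr)
    (g := NonUnitalStarAlgHom.id ℂ C) D.snd_inr c.2
  inl_fst_add_inr_snd a := by
    have c1 := continuous_starHom D.fst
    have c2 := continuous_starHom D.snd
    have c3 := continuous_starHom D.inl
    have c4 := continuous_starHom D.inr
    refine Subtype.ext <| rightAlg_induction
      (p := fun a => D.inl (D.fst a) + D.inr (D.snd a) = a) ?_ (by simp) ?_ ?_ ?_ a.2
    · intro x hx y hy
      have o1 := (D.orthogonal _ (D.fst_mem x hx) _ (D.snd_mem y hy)).1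
      have o2 : star (D.inr (D.snd x)) * D.inl (D.fst y) = 0 := by
        simpa using congrArg star (D.orthogonal _ (D.fst_mem y hy) _ (D.snd_mem x hx)).1
      conv_rhs => rw [← D.inl_fst_add_inr_snd x hx, ← D.inl_fst_add_inr_snd y hy]
      simp only [map_mul, map_star, star_add, mul_add, add_mul, o1, o2, add_zero, zero_add]
    · intro x y h1 h2
      conv_rhs => rw [← h1, ← h2]
      simp only [map_add]
      abel
    · intro c x h1
      conv_rhs => rw [← h1]
      simp only [map_smul, smul_add]
    · exact isClosed_eq (by fun_prop) continuous_id

end DirectSum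

/-- The right scale of `T` inside `K₀(L(T))`: the scale of `R(T)`, transported by
`K₀(ι_L)⁻¹ K₀(ι_R)`. -/
def rightScale (T : TRO A) : Set (K0 T.leftAlg) :=
  K0.map T.leftIncl ⁻¹' (K0.map T.rightIncl '' K0.scale T.rightAlg)

theorem map_leftIncl_map_leftMap {S : TRO A} {T : TRO B} (f : A →⋆ₙₐ[ℂ] B)
    (hf : ∀ x ∈ S.carrier, f x ∈ T.carrier) (x : K0 S.leftAlg) :
    K0.map T.leftIncl (K0.map (leftMap f hf) x) =
      K0.map (linkingMap f hf) (K0.map S.leftIncl x) := by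
  rw [← AddMonoidHom.comp_apply, ← AddMonoidHom.comp_apply, ← K0.map_comp, ← K0.map_comp,
    linkingMap_comp_leftIncl]

theorem map_rightIncl_map_rightMap {S : TRO A} {T : TRO B} (f : A →⋆ₙₐ[ℂ] B)
    (hf : ∀ x ∈ S.carrier, f x ∈ T.carrier) (x : K0 S.rightAlg) :
    K0.map T.rightIncl (K0.map (rightMap f hf) x) =
      K0.map (linkingMap f hf) (K0.map S.rightIncl x) := by
  rw [← AddMonoidHom.comp_apply, ← AddMonoidHom.comp_apply, ← K0.map_comp, ← K0.map_comp,
    linkingMap_comp_rightIncl]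

/-- Morphisms of TROs preserve right scales. -/
theorem map_leftMap_mem_rightScale {S : TRO A} {T : TRO B} (f : A →⋆ₙₐ[ℂ] B)
    (hf : ∀ x ∈ S.carrier, f x ∈ T.carrier) {x : K0 S.leftAlg} (hx : x ∈ S.rightScale) :
    K0.map (leftMap f hf) x ∈ T.rightScale := by
  obtain ⟨_, ⟨p, hp, rfl⟩, h⟩ := hx
  refine ⟨K0.map (rightMap f hf) (K0.cls p hp), ⟨_, _, K0.map_cls _ p hp⟩, ?_⟩
  rw [map_rightIncl_map_rightMap, h, map_leftIncl_map_leftMap]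

/-- Over a direct sum, elements of the right scales of the summands add up to an element of the
right scale, since orthogonal projections of the right algebra have a projection as their sum. -/
theorem DirectSum.add_mem_rightScale {T : TRO A} {T₁ : TRO B} {T₂ : TRO C}
    (D : DirectSum T T₁ T₂) {x : K0 T₁.leftAlg} {y : K0 T₂.leftAlg} (hx : x ∈ T₁.rightScale)
    (hy : y ∈ T₂.rightScale) : K0.map D.left.inl x + K0.map D.left.inr y ∈ T.rightScale := by
  obtain ⟨_, ⟨p, hp, rfl⟩, h⟩ := hx
  obtain ⟨_, ⟨q, hq, rfl⟩, h'⟩ := hy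
  refine ⟨_, ⟨_, _, D.right.map_inl_cls_add_map_inr_cls hp hq⟩, ?_⟩
  rw [map_add, map_add]
  refine congrArg₂ (· + ·) ?_ ?_
  · exact (map_rightIncl_map_rightMap _ D.inl_mem _).trans
      ((congrArg _ h).trans (map_leftIncl_map_leftMap _ D.inl_mem _).symm)
  · exact (map_rightIncl_map_rightMap _ D.inr_mem _).trans
      ((congrArg _ h').trans (map_leftIncl_map_leftMap _ D.inr_mem _).symm)

end TRO

/-! ### Functoriality of the universal enveloping TRO -/

section Envelope
variable {Z : Type*} [NormedAddCommGroup Z] [NormedSpace ℂ Z] [CompleteSpace Z] [JBStarTriple Z]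
variable {Z' : Type*} [NormedAddCommGroup Z'] [NormedSpace ℂ Z'] [CompleteSpace Z']
  [JBStarTriple Z']

/-- The composition of a JB*-morphism on `Z'` with a bounded triple homomorphism `Z → Z'`. -/
def JBRep.comp (π : JBRep.{w} Z') (f : Z →L[ℂ] Z') (hf : ∀ x y z, f (tp x y z) =
    tp (f x) (f y) (f z)) : JBRep.{w} Z where
  B := π.B
  hom := π.hom.comp f
  map_tp x y z := by simp only [ContinuousLinearMap.comp_apply, hf, π.map_tp]

/-- The `*`-homomorphism of enveloping C*-algebras induced by a bounded triple homomorphism `f`: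
its `π`-th coordinate is the `π ∘ f`-th coordinate of its argument. -/
noncomputable def EnvAlg.map (f : Z →L[ℂ] Z')
    (hf : ∀ x y z, f (tp x y z) = tp (f x) (f y) (f z)) :
    EnvAlg.{w} Z →⋆ₙₐ[ℂ] EnvAlg.{w} Z' where
  toFun F := ⟨fun π => F (π.comp f hf), memℓp_infty ⟨‖F‖, by
    rintro _ ⟨π, rfl⟩
    exact lp.norm_apply_le_norm ENNReal.top_ne_zero F (π.comp f hf)⟩⟩
  map_smul' c F := rfl
  map_zero' := rfl
  map_add' F G := rfl
  map_mul' F G := rfl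
  map_star' F := rfl

variable (f : Z →L[ℂ] Z') (hf : ∀ x y z, f (tp x y z) = tp (f x) (f y) (f z))

theorem EnvAlg.map_mem_univTRO (F : EnvAlg.{w} Z) (hF : F ∈ (univTRO Z).carrier) :
    EnvAlg.map f hf F ∈ (univTRO Z').carrier :=
  TRO.map_mem_of_generate _ (by rintro _ ⟨z, rfl⟩; exact rho_mem (f z)) hF

end Envelope

/-! ### The enveloping TRO of a direct sum -/

section DirectSum
variable (Z₁ : Type u₁) [NormedAddCommGroup Z₁] [NormedSpace ℂ Z₁] [CompleteSpace Z₁]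
  [JBStarTriple Z₁]
variable (Z₂ : Type u₂) [NormedAddCommGroup Z₂] [NormedSpace ℂ Z₂] [CompleteSpace Z₂]
  [JBStarTriple Z₂]

namespace EnvAlg

/-- The coordinate `*`-homomorphism of `EnvAlg (Z₁ × Z₂)` covering `Z₁ × Z₂ → Z₁`. -/
noncomputable def fst : EnvAlg.{w} (Z₁ × Z₂) →⋆ₙₐ[ℂ] EnvAlg.{w} Z₁ :=
  map (ContinuousLinearMap.fst ℂ Z₁ Z₂) fun _ _ _ => rfl

/-- The coordinate `*`-homomorphism of `EnvAlg (Z₁ × Z₂)` covering `Z₁ × Z₂ → Z₂`. -/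
noncomputable def snd : EnvAlg.{w} (Z₁ × Z₂) →⋆ₙₐ[ℂ] EnvAlg.{w} Z₂ :=
  map (ContinuousLinearMap.snd ℂ Z₁ Z₂) fun _ _ _ => rfl

/-- The `*`-homomorphism into `EnvAlg (Z₁ × Z₂)` covering the embedding of `Z₁`. -/
noncomputable def inl : EnvAlg.{w} Z₁ →⋆ₙₐ[ℂ] EnvAlg.{w} (Z₁ × Z₂) :=
  map (ContinuousLinearMap.inl ℂ Z₁ Z₂) fun _ _ _ =>
    Prod.ext rfl ((box (0 : Z₂) 0).map_zero).symm

/-- The `*`-homomorphism into `EnvAlg (Z₁ × Z₂)` covering the embedding of `Z₂`. -/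
noncomputable def inr : EnvAlg.{w} Z₂ →⋆ₙₐ[ℂ] EnvAlg.{w} (Z₁ × Z₂) :=
  map (ContinuousLinearMap.inr ℂ Z₁ Z₂) fun _ _ _ =>
    Prod.ext ((box (0 : Z₁) 0).map_zero).symm rfl

theorem rho_zero (Z : Type*) [NormedAddCommGroup Z] [NormedSpace ℂ Z] [CompleteSpace Z]
    [JBStarTriple Z] : rho.{w} (0 : Z) = 0 := by
  ext π
  exact π.hom.map_zero

variable {Z₁ Z₂}

/-- The two summands of `Z₁ × Z₂` are represented by `*`-orthogonal elements, because
`{x, x, y} = 0` for `x` in the first and `y` in the second. -/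
theorem rho_orthogonal (x : Z₁) (y : Z₂) :
    star (rho.{w} (x, (0 : Z₂))) * rho ((0 : Z₁), y) = 0 ∧
      rho.{w} (x, (0 : Z₂)) * star (rho ((0 : Z₁), y)) = 0 := by
  have h0 : tp (x, (0 : Z₂)) (x, 0) ((0 : Z₁), y) = 0 := by
    refine Prod.ext ((box x x).map_zero) ?_
    change tp (0 : Z₂) 0 y = 0
    rw [tp, TripleSystem.tp_symm]
    exact (box y 0).map_zero
  have h (π : JBRep.{w} (Z₁ × Z₂)) := star_mul_eq_zero_of_triple_eq_zero
    (x := π.hom (x, 0)) (y := π.hom (0, y)) (by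
      have := π.map_tp (x, 0) (x, 0) (0, y)
      rw [h0, map_zero] at this
      exact (smul_eq_zero.1 this.symm).resolve_left (by norm_num))
  exact ⟨by ext π; exact (h π).1, by ext π; exact (h π).2⟩

end EnvAlg

/-- `T*(Z₁ × Z₂) = T*(Z₁) ⊕ T*(Z₂)`. -/
noncomputable def univTRODirectSum :
    (univTRO.{w} (Z₁ × Z₂)).DirectSum (univTRO.{w} Z₁) (univTRO.{w} Z₂) where
  fst := EnvAlg.fst Z₁ Z₂
  snd := EnvAlg.snd Z₁ Z₂
  inl := EnvAlg.inl Z₁ Z₂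
  inr := EnvAlg.inr Z₁ Z₂
  fst_mem := EnvAlg.map_mem_univTRO _ _
  snd_mem := EnvAlg.map_mem_univTRO _ _
  inl_mem := EnvAlg.map_mem_univTRO _ _
  inr_mem := EnvAlg.map_mem_univTRO _ _
  fst_inl _ hx := TRO.eqOn_generate (f := (EnvAlg.fst Z₁ Z₂).comp (EnvAlg.inl Z₁ Z₂))
    (g := NonUnitalStarAlgHom.id ℂ _) (by rintro _ ⟨z, rfl⟩; rfl) hx
  fst_inr _ hx := TRO.eqOn_generate (f := (EnvAlg.fst Z₁ Z₂).comp (EnvAlg.inr Z₁ Z₂)) (g := 0)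
    (by rintro _ ⟨z, rfl⟩; exact EnvAlg.rho_zero Z₁) hx
  snd_inl _ hx := TRO.eqOn_generate (f := (EnvAlg.snd Z₁ Z₂).comp (EnvAlg.inl Z₁ Z₂)) (g := 0)
    (by rintro _ ⟨z, rfl⟩; exact EnvAlg.rho_zero Z₂) hx
  snd_inr _ hx := TRO.eqOn_generate (f := (EnvAlg.snd Z₁ Z₂).comp (EnvAlg.inr Z₁ Z₂))
    (g := NonUnitalStarAlgHom.id ℂ _) (by rintro _ ⟨z, rfl⟩; rfl) hx
  orthogonal _ hx _ hy := TRO.orthogonal_of_generate _ _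
    (by rintro _ ⟨x, rfl⟩ _ ⟨y, rfl⟩; exact EnvAlg.rho_orthogonal x y) hx hy
  inl_fst_add_inr_snd _ hx := TRO.inl_fst_add_inr_snd_of_generate
    (T₁ := univTRO.{w} Z₁) (T₂ := univTRO.{w} Z₂) _ _ _ _
    (by rintro _ ⟨z, rfl⟩; exact rho_mem z.1) (by rintro _ ⟨z, rfl⟩; exact rho_mem z.2)
    (fun _ hx _ hy => TRO.orthogonal_of_generate _ _
      (by rintro _ ⟨x, rfl⟩ _ ⟨y, rfl⟩; exact EnvAlg.rho_orthogonal x y) hx hy)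
    (by
      rintro _ ⟨z, rfl⟩
      ext π
      change π.hom (z.1, 0) + π.hom (0, z.2) = π.hom z
      rw [← map_add]
      simp) hx

end DirectSum

/-! ### The invariant of a direct sum -/

/-- A group isomorphism mapping the four distinguished subsets onto the corresponding ones is a
K-JB* isomorphism. -/
def KJBIso.ofMemIff {X : KJBData.{u₁}} {Y : KJBData.{u₂}} (e : X.K ≃+ Y.K)
    (pos : ∀ x, e x ∈ Y.pos ↔ x ∈ X.pos) (scaleL : ∀ x, e x ∈ Y.scaleL ↔ x ∈ X.scaleL)
    (scaleR : ∀ x, e x ∈ Y.scaleR ↔ x ∈ X.scaleR)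
    (delta : ∀ x, e x ∈ Y.delta ↔ x ∈ X.delta) : KJBIso X Y where
  equiv := e
  isMorphism := by
    constructor <;> rintro _ ⟨x, hx, rfl⟩
    exacts [(pos x).2 hx, (scaleL x).2 hx, (scaleR x).2 hx, (delta x).2 hx]
  isMorphism_symm := by
    constructor <;> rintro _ ⟨y, hy, rfl⟩ <;> obtain ⟨x, rfl⟩ := e.surjective y <;>
      change e.symm (e x) ∈ _ <;> rw [e.symm_apply_apply]
    exacts [(pos x).1 hy, (scaleL x).1 hy, (scaleR x).1 hy, (delta x).1 hy]

theorem mainTheorem4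
    {Z₁ : Type u₁} [NormedAddCommGroup Z₁] [NormedSpace ℂ Z₁] [CompleteSpace Z₁]
    [FiniteDimensional ℂ Z₁] [JBStarTriple Z₁]
    {Z₂ : Type u₂} [NormedAddCommGroup Z₂] [NormedSpace ℂ Z₂] [CompleteSpace Z₂]
    [FiniteDimensional ℂ Z₂] [JBStarTriple Z₂] :
    Nonempty (KJBIso (KJB.{w} (Z₁ × Z₂)) ((KJB.{w} Z₁).directSum (KJB.{w} Z₂))) := by
  let D := univTRODirectSum.{w} Z₁ Z₂
  refine ⟨KJBIso.ofMemIff (X := KJB.{w} (Z₁ × Z₂))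
    (Y := (KJB.{w} Z₁).directSum (KJB.{w} Z₂)) D.left.k0Equiv ?_ ?_ ?_ ?_⟩
  · refine fun x => ⟨?_, ?_⟩
    · rintro ⟨⟨P, hP⟩, ⟨Q, hQ⟩⟩
      refine ⟨(P.map D.left.inl).sum (Q.map D.left.inr), ?_⟩
      rw [← K0.mk_add_mk, ← K0.map_mk, ← K0.map_mk, hP, hQ]
      exact D.left.k0Equiv.symm_apply_apply x
    · rintro ⟨P, rfl⟩
      exact ⟨⟨_, (K0.map_mk D.left.fst P).symm⟩, ⟨_, (K0.map_mk D.left.snd P).symm⟩⟩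
  · refine fun x => ⟨?_, ?_⟩
    -- The images of two projections of the summands are orthogonal, so the sum of their classes is
    -- the class of one projection of the algebra itself.
    · rintro ⟨⟨p, hp, h1⟩, ⟨q, hq, h2⟩⟩
      refine ⟨_, D.left.isStarProjection_add hp hq, ?_⟩
      rw [← D.left.map_inl_cls_add_map_inr_cls hp hq, ← h1, ← h2]
      exact (D.left.k0Equiv.symm_apply_apply x).symm
    · rintro ⟨p, hp, rfl⟩
      exact ⟨⟨_, _, K0.map_cls D.left.fst p hp⟩, ⟨_, _, K0.map_cls D.left.snd p hp⟩⟩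
  · refine fun x => ⟨?_, ?_⟩
    · rintro ⟨h1, h2⟩
      have := D.add_mem_rightScale h1 h2
      exact (D.left.k0Equiv.symm_apply_apply x) ▸ this
    · exact fun h => ⟨TRO.map_leftMap_mem_rightScale _ D.fst_mem h,
        TRO.map_leftMap_mem_rightScale _ D.snd_mem h⟩
  · refine fun x => ⟨?_, ?_⟩
    -- A pair `(g, g')` is a tripotent if and only if `g` and `g'` are, and the coordinates of
    -- `ρ (g, g')` are `ρ g` and `ρ g'`.
    · rintro ⟨⟨g, hg, h1⟩, ⟨g', hg', h2⟩⟩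
      have hgg : tp (g, g') (g, g') (g, g') = (g, g') := Prod.ext hg hg'
      refine ⟨(g, g'), hgg, D.left.k0Equiv.injective (Prod.ext ?_ ?_)⟩
      · exact h1.trans (K0.map_cls D.left.fst _ (isStarProjection_suppElem hgg)).symm
      · exact h2.trans (K0.map_cls D.left.snd _ (isStarProjection_suppElem hgg)).symm
    · rintro ⟨g, hg, rfl⟩
      exact ⟨⟨g.1, congrArg Prod.fst hg, K0.map_cls D.left.fst _ _⟩,
        ⟨g.2, congrArg Prod.snd hg, K0.map_cls D.left.snd _ _⟩⟩
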